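/- All graphs are finite and simple; $\Delta(G)$ is the maximum degree, $\nu(G)$ the matching number (largest size of a matching), and $c=c(d):=\lceil\frac{d-1}{2}\rceil$. For integers $d,m\ge 2$ let $\mathcal F(d,m)$ be the family of graphs $G$ with $\Delta(G)<d$ and $\nu(G)<m$ that are edge-maximal, i.e. every graph $G'$ (possibly with more vertices) that has $G$ as a subgraph and satisfies $|E(G')|>|E(G)|$ has $\Delta(G')\ge d$ or $\nu(G')\ge m$. Let $e(d,m)=\sup_{G\in\mathcal F(d,m)}|E(G)|$. An *extremal graph* for $(d,m)$ is a graph $G\in\mathcal F(d,m)$ without isolated vertices and with $|E(G)|=e(d,m)$. Let $C=C(d)$ be the following graph on $2c+1$ vertices. If $d=2j+1$, then $C=K_{2j+1}$. If $d=2j$, then take the complete graph $K_{2j}$, remove $j$ alternate edges of a Hamiltonian cycle (a perfect matching), add one new vertex, and join it to all but one of the $2j$ old vertices. A graph is *factor-critical* if deleting any vertex leaves a graph with a perfect matching. **Theorem.** Let $d,m\ge 2$. 1. The extremal graph for $(d,m)$ is unique up to isomorphism if and only if $d=2$, or $m=2$ and $d\ne 4$, or $c$ divides $m-1$. 2. If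 $d=2$, the unique extremal graph is the disjoint union of $m-1$ copies of $K_2$. 3. If $m=2$ and $d\notin\{3,4\}$, then $e(d,2)=d-1$ and the unique extremal graph is the star $K_{1,d-1}$. 4. If $d\ge 3$ and $c$ divides $m-1$, the unique extremal graph is the disjoint union of $\frac{m-1}{c}$ copies of $C$. (In particular it is $K_3$ for $d=3$, $m=2$.) 5. If $d\ge 3$, then $C$ is factor-critical with $\nu(C)=c$, $\Delta(C)<d$ and $|E(C)|=\lfloor\frac{(2c+1)(d-1)}{2}\rfloor$, and up to isomorphism it is the only graph with these properties. 6. If $d>2$, $m>2$ and $c$ does not divide $m-1$, there are several (at least two non-isomorphic) extremal graphs. The same holds for $d=4$, $m=2$. 7. If $d=m=s$ is odd, then $e(s,s)=s(s-1)$ and the unique extremal graph is $2K_s$, two disjoint copies of $K_s$. If $d=m=s$ is even, then $e(s,s)=\lfloor\frac{(2s-1)(s-1)}{2}\rfloor$, and for $s\ge 4$ there are several (at least two non-isomorphic) extremal graphs. -/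

import Mathlib

namespace DegreeMatching

open SimpleGraph

/-- The number of edges `|E(G)|`. -/
noncomputable def numEdges {V : Type} (G : SimpleGraph V) : ℕ :=
  G.edgeSet.ncard

open Classical in
/-- The maximum degree `Δ(G)` of a finite graph (it is `0` if there are no vertices). -/
noncomputable def maxDeg {V : Type} [Fintype V] (G : SimpleGraph V) : ℕ :=
  G.maxDegree

/-- The matching number `ν(G)`: the largest number of edges of a matching of `G`. -/
noncomputable def matchingNum {V : Type} (G : SimpleGraph V) : ℕ :=
  sSup {n | ∃ M : G.Subgraph, M.IsMatching ∧ M.edgeSet.ncard = n}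

/-- Membership in the family `F(d,m)`: `Δ(G) < d`, `ν(G) < m`, and every finite graph `H`
(possibly with more vertices) that contains `G` as a subgraph and has more edges than `G`
violates one of these two bounds. -/
def InFamily (d m : ℕ) {V : Type} [Fintype V] (G : SimpleGraph V) : Prop :=
  maxDeg G < d ∧ matchingNum G < m ∧
    ∀ (W : Type) [Fintype W] (H : SimpleGraph W),
      G.IsContained H → numEdges G < numEdges H → d ≤ maxDeg H ∨ m ≤ matchingNum H

/-- `e(d,m)`: the supremum of `|E(G)|` over `G ∈ F(d,m)`. -/
noncomputable def maxEdges (d m : ℕ) : ℕ :=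
  sSup {n | ∃ (V : Type) (_ : Fintype V) (G : SimpleGraph V), InFamily d m G ∧ numEdges G = n}

/-- `G` is an extremal graph: a member of `F(d,m)` without isolated vertices that has
`e(d,m)` edges. -/
def IsExtremal (d m : ℕ) {V : Type} [Fintype V] (G : SimpleGraph V) : Prop :=
  InFamily d m G ∧ (∀ v, ∃ w, G.Adj v w) ∧ numEdges G = maxEdges d m

/-- Up to isomorphism, `G` is the only extremal graph. -/
def IsTheExtremal (d m : ℕ) {V : Type} [Fintype V] (G : SimpleGraph V) : Prop :=
  IsExtremal d m G ∧
    ∀ (W : Type) [Fintype W] (H : SimpleGraph W), IsExtremal d m H → Nonempty (H ≃g G)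

/-- There is exactly one extremal graph up to isomorphism. -/
def HasUniqueExtremal (d m : ℕ) : Prop :=
  ∃ (V : Type) (_ : Fintype V) (G : SimpleGraph V), IsTheExtremal d m G

/-- There are (at least) two non-isomorphic extremal graphs. -/
def HasSeveralExtremal (d m : ℕ) : Prop :=
  ∃ (V : Type) (_ : Fintype V) (G : SimpleGraph V) (W : Type) (_ : Fintype W)
    (H : SimpleGraph W), IsExtremal d m G ∧ IsExtremal d m H ∧ IsEmpty (G ≃g H)

/-- The complete graph `K_n`. -/
abbrev complete (n : ℕ) : SimpleGraph (Fin n) := ⊤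

/-- The star `K_{1,k}`. -/
abbrev star (k : ℕ) : SimpleGraph (Fin 1 ⊕ Fin k) :=
  completeBipartiteGraph (Fin 1) (Fin k)

/-- The disjoint union of `k` copies of `G`. -/
def copies (k : ℕ) {V : Type} (G : SimpleGraph V) : SimpleGraph (Fin k × V) where
  Adj x y := x.1 = y.1 ∧ G.Adj x.2 y.2
  symm := ⟨fun _ _ h => ⟨h.1.symm, h.2.symm⟩⟩
  loopless := ⟨fun _ h => G.loopless.irrefl _ h.2⟩

/-- `⌈(d - 1) / 2⌉`. -/
def halfCeil (d : ℕ) : ℕ := (d - 1) ⌈/⌉ 2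

/-- Take the complete graph on `0, …, 2j - 1`, delete the alternate edges
`{0,1}, {2,3}, …, {2j - 2, 2j - 1}` of the Hamiltonian cycle `0, 1, …, 2j - 1`, add a new
vertex `none`, and join it to all of the old vertices except the vertex `0`. -/
def evenC (j : ℕ) : SimpleGraph (Option (Fin (2 * j))) where
  Adj x y :=
    match x, y with
    | none, none => False
    | none, some a => a.val ≠ 0
    | some a, none => a.val ≠ 0
    | some a, some b => a.val / 2 ≠ b.val / 2
  symm := ⟨by
    rintro (_ | a) (_ | b) h
    · exact h
    · exact h
    · exact h
    · exact Ne.symm h⟩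
  loopless := ⟨by
    rintro (_ | a) h
    · exact h
    · exact h rfl⟩

open Classical in
/-- The graph `C` on `2⌈(d - 1) / 2⌉ + 1` vertices: for odd `d = 2j + 1` it is complete, for even
`d = 2j` it is `evenC j`. -/
noncomputable def graphC (d : ℕ) : SimpleGraph (Option (Fin (2 * halfCeil d))) :=
  if Odd d then ⊤ else evenC (halfCeil d)

/-- Factor-critical graphs: deleting any vertex leaves a graph with a perfect matching. -/
def FactorCritical {V : Type} (G : SimpleGraph V) : Prop :=
  ∀ v : V, ∃ M : (G.induce {v}ᶜ).Subgraph, M.IsPerfectMatching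

/-- `G` is factor-critical with `ν(G) = ⌈(d - 1) / 2⌉`, `Δ(G) < d` and
`⌊(2⌈(d - 1) / 2⌉ + 1)(d - 1) / 2⌋` edges. -/
def IsLargestCritical (d : ℕ) {V : Type} [Fintype V] (G : SimpleGraph V) : Prop :=
  FactorCritical G ∧ matchingNum G = halfCeil d ∧ maxDeg G < d ∧
    numEdges G = (2 * halfCeil d + 1) * (d - 1) / 2

end DegreeMatching

/-! Write c = ⌈(d-1)/2⌉. The Tutte–Berge formula (`exists_splits_le_matchingNum`) gives a vertex set
A and classes of sizes n_i outside A, with no edges between different classes, such that |A| +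
Σ⌊n_i/2⌋ ≤ ν(G) ≤ m-1. A vertex of A meets at most d-1 edges. A class with k = ⌊n_i/2⌋ spans at most
k(d-1) edges, plus a bonus ⌊(d-1)/2⌋ that is available only if k ≥ c. Each bonus uses up c of the
budget m-1, so |E| ≤ (d-1)(m-1) + ⌊(d-1)/2⌋⌊(m-1)/c⌋ (`numEdges_le_extremalSize`). Writing m-1 = qc
+ r with r < c, the union of q copies of C and r stars attains the bound.

If c divides m-1 and d ≥ 3, equality leaves no slack (`exists_parts_of_numEdges_eq`): A is empty and
every class is either a single vertex, which would be isolated, or has 2c+1 vertices and the maximum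
number of edges. Such a class is C, because its complement is empty (d odd) or a path with two edges
plus a matching (d even); see `nonempty_iso_graphC`.

If c does not divide m-1, then c ≥ 2 and r ≥ 1, and part of the construction can be exchanged. For r
≥ 2 the r stars give way to K_{r,d-1}. For r = 1 and q ≥ 1 one C and the star give way to a nearly
regular graph on 2c+3 vertices. The case r = 1, q = 0 is m = 2, where a class carries at most three
edges: the star wins alone for d ≥ 5 and ties with the triangle for d = 4. -/

namespace DegreeMatching

open SimpleGraph Finset

/-! ### Degrees, matchings and their elementary counts -/

section Basics

variable {V : Type}

theorem halfCeil_eq (d : ℕ) : halfCeil d = d / 2 := by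
  unfold halfCeil
  rw [Nat.ceilDiv_eq_add_pred_div]
  omega

theorem ncard_neighborSet (G : SimpleGraph V) (v : V) [Fintype (G.neighborSet v)] :
    (G.neighborSet v).ncard = G.degree v :=
  Set.ncard_eq_toFinset_card' _

theorem sum_ncard_neighborSet [Fintype V] (G : SimpleGraph V) :
    ∑ v, (G.neighborSet v).ncard = 2 * numEdges G := by
  classical
  have h := G.sum_degrees_eq_twice_card_edges
  rw [numEdges, ← coe_edgeFinset, Set.ncard_coe_finset, ← h]
  exact Finset.sum_congr rfl fun v _ => ncard_neighborSet G v

theorem maxDeg_lt_iff [Fintype V] {G : SimpleGraph V} {d : ℕ} (hd : 0 < d) :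
    maxDeg G < d ↔ ∀ v, (G.neighborSet v).ncard < d := by
  classical
  unfold maxDeg
  constructor
  · intro h v
    rw [ncard_neighborSet]
    refine lt_of_le_of_lt ?_ h
    convert G.degree_le_maxDegree v
  · intro h
    have : G.maxDegree ≤ d - 1 := G.maxDegree_le_of_forall_degree_le _ fun v => by
      have := h v
      rw [ncard_neighborSet] at this
      omega
    convert lt_of_le_of_lt this (Nat.sub_lt hd one_pos)

theorem bddAbove_matching [Finite V] (G : SimpleGraph V) :
    BddAbove {n | ∃ M : G.Subgraph, M.IsMatching ∧ M.edgeSet.ncard = n} := by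
  refine ⟨G.edgeSet.ncard, ?_⟩
  rintro _ ⟨M, -, rfl⟩
  exact Set.ncard_le_ncard M.edgeSet_subset (Set.toFinite _)

theorem le_matchingNum [Finite V] {G : SimpleGraph V} {M : G.Subgraph} (hM : M.IsMatching) :
    M.edgeSet.ncard ≤ matchingNum G :=
  le_csSup (bddAbove_matching G) ⟨M, hM, rfl⟩

theorem exists_matching [Finite V] (G : SimpleGraph V) :
    ∃ M : G.Subgraph, M.IsMatching ∧ M.edgeSet.ncard = matchingNum G :=
  Nat.sSup_mem (s := {n | ∃ M : G.Subgraph, M.IsMatching ∧ M.edgeSet.ncard = n})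
    ⟨0, ⊥, by simp [Subgraph.IsMatching], by simp⟩ (bddAbove_matching G)

theorem two_mul_ncard_edgeSet [Finite V] {G : SimpleGraph V} {M : G.Subgraph} (hM : M.IsMatching) :
    2 * M.edgeSet.ncard = M.verts.ncard := by
  classical
  have := Fintype.ofFinite V
  have h1 : numEdges M.spanningCoe = M.edgeSet.ncard := by
    simp [numEdges]
  rw [← h1, ← sum_ncard_neighborSet]
  have : ∀ v, (M.spanningCoe.neighborSet v).ncard = if v ∈ M.verts then 1 else 0 := by
    intro v
    split_ifs with hv
    · obtain ⟨w, hw, hw'⟩ := hM hv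
      rw [Set.ncard_eq_one]
      exact ⟨w, Set.ext fun x => ⟨fun hx => hw' x hx, fun hx => hx ▸ hw⟩⟩
    · rw [Set.ncard_eq_zero]
      exact Set.eq_empty_of_forall_notMem fun x hx => hv (M.edge_vert hx)
  simp_rw [this]
  rw [Finset.sum_ite, Finset.sum_const_zero, add_zero, Finset.sum_const, smul_eq_mul, mul_one,
    ← Set.ncard_coe_finset]
  simp

theorem two_mul_matchingNum_le [Fintype V] (G : SimpleGraph V) :
    2 * matchingNum G ≤ Fintype.card V := by
  obtain ⟨M, hM, h⟩ := exists_matching G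
  rw [← h, two_mul_ncard_edgeSet hM, ← Nat.card_eq_fintype_card]
  exact Set.ncard_le_card _

end Basics

/-- `A` together with the classes of `comp` outside `A` splits `G`: an edge that avoids `A` stays
inside one class. -/
def Splits {V ι : Type} (G : SimpleGraph V) (A : Finset V) (comp : V → ι) : Prop :=
  ∀ ⦃v w⦄, v ∉ A → w ∉ A → G.Adj v w → comp v = comp w

/-- The class of `i` outside `A`. -/
def part {V ι : Type} (A : Finset V) (comp : V → ι) (i : ι) : Set V :=
  {v | v ∉ A ∧ comp v = i}

/-! ### Bounds on matchings and edges from a splitting set -/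

section Splits

theorem edgeSet_subset_of_splits {V ι : Type} {G : SimpleGraph V} {A : Finset V} {comp : V → ι}
    (h : Splits G A comp) {e : Sym2 V} (he : e ∈ G.edgeSet) :
    (∃ a ∈ A, a ∈ e) ∨ ∃ i, ∀ v ∈ e, v ∈ part A comp i := by
  by_cases hA : ∃ a ∈ A, a ∈ e
  · exact Or.inl hA
  · right
    push Not at hA
    induction e with | _ x y
    refine ⟨comp x, fun v hv => ?_⟩
    have hx := mt (hA x) (by simp)
    have hy := mt (hA y) (by simp)
    rcases Sym2.mem_iff.1 hv with rfl | rfl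
    · exact ⟨hx, rfl⟩
    · exact ⟨hy, (h hx hy he).symm⟩

theorem two_mul_card_le_of_disjoint {V : Type} [Finite V] {S : Finset (Sym2 V)} {D : Set V}
    (hdiag : ∀ e ∈ S, ¬ e.IsDiag) (hdisj : ∀ e ∈ S, ∀ f ∈ S, ∀ v, v ∈ e → v ∈ f → e = f)
    (hD : ∀ e ∈ S, ∀ v ∈ e, v ∈ D) : 2 * S.card ≤ D.ncard := by
  classical
  have := Fintype.ofFinite V
  have h1 : (S.biUnion Sym2.toFinset).card = 2 * S.card := by
    rw [Finset.card_biUnion, Finset.sum_const_nat (m := 2), mul_comm]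
    · intro e he
      exact Sym2.card_toFinset_of_not_isDiag _ (hdiag e he)
    · intro e he f hf hne
      rw [Function.onFun, Finset.disjoint_left]
      intro v hv hv'
      rw [Sym2.mem_toFinset] at hv hv'
      exact hne (hdisj e he f hf v hv hv')
  rw [← h1, ← Set.ncard_coe_finset]
  refine Set.ncard_le_ncard ?_ (Set.toFinite _)
  intro v hv
  simp only [Finset.coe_biUnion, Set.mem_iUnion, Finset.mem_coe, Sym2.mem_toFinset] at hv
  obtain ⟨e, he, hv⟩ := hv
  exact hD e he v hv

variable {V ι : Type} [Fintype ι]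

/-- The easy half of Tutte–Berge: a vertex of `A` lies on at most one matching edge, and each
remaining matching edge uses two vertices of a single class. It also bounds the matching numbers of
the constructions. -/
theorem matchingNum_le_of_splits [Finite V] {G : SimpleGraph V} {A : Finset V} {comp : V → ι}
    (h : Splits G A comp) : matchingNum G ≤ A.card + ∑ i, (part A comp i).ncard / 2 := by
  classical
  obtain ⟨M, hM, hcard⟩ := exists_matching G
  have := Fintype.ofFinite V
  rw [← hcard]
  have hinj : ∀ e ∈ M.edgeSet, ∀ f ∈ M.edgeSet, ∀ v, v ∈ e → v ∈ f → e = f := by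
    intro e he f hf v hve hvf
    obtain ⟨x, rfl⟩ := hve
    obtain ⟨y, rfl⟩ := hvf
    exact congrArg (fun z => s(v, z)) (hM.eq_of_adj_left he hf)
  let S := M.edgeSet.toFinset
  have hS : ∀ e, e ∈ S ↔ e ∈ M.edgeSet := by simp [S]
  have hsub : S ⊆ (A.biUnion fun a => {e ∈ S | a ∈ e}) ∪
      (univ.biUnion fun i => {e ∈ S | ∀ v ∈ e, v ∈ part A comp i}) := by
    intro e he
    have := edgeSet_subset_of_splits h (M.edgeSet_subset ((hS e).1 he))
    simp only [mem_union, mem_biUnion, mem_filter, mem_univ, true_and]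
    rcases this with ⟨a, ha, hae⟩ | ⟨i, hi⟩
    · exact Or.inl ⟨a, ha, he, hae⟩
    · exact Or.inr ⟨i, he, hi⟩
  rw [Set.ncard_eq_toFinset_card']
  refine (Finset.card_le_card hsub).trans ((Finset.card_union_le _ _).trans
    (add_le_add (Finset.card_biUnion_le.trans ?_) (Finset.card_biUnion_le.trans ?_)))
  · rw [Finset.card_eq_sum_ones]
    refine Finset.sum_le_sum fun a _ => ?_
    rw [Finset.card_le_one]
    intro e he f hf
    rw [mem_filter, hS] at he hf
    exact hinj e he.1 f hf.1 a he.2 hf.2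
  · refine Finset.sum_le_sum fun i _ => ?_
    rw [Nat.le_div_iff_mul_le two_pos, mul_comm]
    refine two_mul_card_le_of_disjoint ?_ ?_ ?_
    · intro e he
      rw [mem_filter, hS] at he
      exact G.not_isDiag_of_mem_edgeSet (M.edgeSet_subset he.1)
    · intro e he f hf
      rw [mem_filter, hS] at he hf
      exact hinj e he.1 f hf.1
    · intro e he
      rw [mem_filter] at he
      exact he.2

/-- Edges meeting `A` are counted at their ends in `A`, possibly twice; every other edge lies inside
one class. -/
theorem numEdges_le_of_splits [Fintype V] {G : SimpleGraph V} {A : Finset V} {comp : V → ι}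
    (h : Splits G A comp) :
    numEdges G ≤ ∑ a ∈ A, (G.neighborSet a).ncard +
      ∑ i, numEdges (G.induce (part A comp i)) := by
  classical
  let T : ι → Finset (Sym2 V) := fun i =>
    (G.induce (part A comp i)).edgeFinset.image (Sym2.map (↑))
  have hsub : G.edgeFinset ⊆ (A.biUnion fun a => (G.neighborFinset a).image fun w => s(a, w)) ∪
      univ.biUnion T := by
    intro e he
    rw [mem_edgeFinset] at he
    simp only [mem_union, mem_biUnion, mem_univ, true_and, mem_image, T, mem_neighborFinset,
      mem_edgeFinset]
    rcases edgeSet_subset_of_splits h he with ⟨a, ha, w, rfl⟩ | ⟨i, hi⟩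
    · exact Or.inl ⟨a, ha, w, he, rfl⟩
    · right
      induction e with | _ x y
      exact ⟨i, s(⟨x, hi x (by simp)⟩, ⟨y, hi y (by simp)⟩), he, rfl⟩
  rw [numEdges, ← coe_edgeFinset, Set.ncard_coe_finset]
  refine (Finset.card_le_card hsub).trans ((Finset.card_union_le _ _).trans
    (add_le_add (Finset.card_biUnion_le.trans ?_) (Finset.card_biUnion_le.trans ?_)))
  · refine Finset.sum_le_sum fun a _ => Finset.card_image_le.trans ?_
    rw [ncard_neighborSet, card_neighborFinset_eq_degree]
  · refine Finset.sum_le_sum fun i _ => Finset.card_image_le.trans ?_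
    rw [numEdges, ← coe_edgeFinset, Set.ncard_coe_finset]

theorem sum_ncard_part [Fintype V] (A : Finset V) (comp : V → ι) :
    A.card + ∑ i, (part A comp i).ncard = Fintype.card V := by
  classical
  have h := Finset.card_eq_sum_card_fiberwise (f := comp) (s := Aᶜ) (t := univ)
    (fun _ _ => by simp)
  have h2 : ∀ i, (part A comp i).ncard = #{v ∈ Aᶜ | comp v = i} := fun i => by
    rw [← Set.ncard_coe_finset]
    congr 1
    ext v
    simp [part]
  simp_rw [h2]
  rw [← h, Finset.card_add_card_compl]

end Splits

/-! ### The Tutte–Berge formula, derived from Tutte's theorem -/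

section TutteBerge

variable {V : Type}

/-- The join of `G` with the complete graph on `k` vertices. -/
def joinComplete (G : SimpleGraph V) (k : ℕ) : SimpleGraph (V ⊕ Fin k) where
  Adj x y := x ≠ y ∧ ∀ v w, x = Sum.inl v → y = Sum.inl w → G.Adj v w
  symm := ⟨fun _ _ h => ⟨h.1.symm, fun v w hv hw => (h.2 w v hw hv).symm⟩⟩
  loopless := ⟨fun _ h => h.1 rfl⟩

theorem joinComplete_adj_inl {G : SimpleGraph V} {k : ℕ} {v w : V} :
    (joinComplete G k).Adj (.inl v) (.inl w) ↔ G.Adj v w :=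
  ⟨fun h => h.2 v w rfl rfl, fun h => ⟨by simpa using h.ne, by
    rintro _ _ ⟨⟩ ⟨⟩
    exact h⟩⟩

theorem joinComplete_adj_inr {G : SimpleGraph V} {k : ℕ} {x : V ⊕ Fin k} {j : Fin k}
    (h : x ≠ .inr j) : (joinComplete G k).Adj x (.inr j) :=
  ⟨h, by simp⟩

/-- A perfect matching of the join restricts to a matching of `G`, and the old vertices it leaves
uncovered are matched injectively to the `k` new ones. -/
theorem card_le_of_isPerfectMatching_joinComplete [Fintype V] {G : SimpleGraph V} {k : ℕ}
    {M : (joinComplete G k).Subgraph} (hM : M.IsPerfectMatching) :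
    Fintype.card V ≤ 2 * matchingNum G + k := by
  classical
  let N : G.Subgraph :=
    { verts := {v | ∃ w, M.Adj (.inl v) (.inl w)}
      Adj := fun v w => M.Adj (.inl v) (.inl w)
      adj_sub := fun h => joinComplete_adj_inl.1 (M.adj_sub h)
      edge_vert := fun h => ⟨_, h⟩
      symm := ⟨fun _ _ h => h.symm⟩ }
  have hN : N.IsMatching := by
    rintro v ⟨w, hw⟩
    exact ⟨w, hw, fun y hy => Sum.inl_injective (hM.1.eq_of_adj_left hy hw)⟩
  have h1 := two_mul_ncard_edgeSet hN
  have h2 := le_matchingNum hN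
  have h3 : N.vertsᶜ.ncard ≤ k := by
    have hex : ∀ v : ↥(N.vertsᶜ), ∃ j, M.Adj (.inl v.1) (.inr j) := by
      rintro ⟨v, hv⟩
      obtain ⟨y, hy, -⟩ := hM.1 (hM.2 (.inl v))
      rcases y with w | j
      · exact absurd ⟨w, hy⟩ hv
      · exact ⟨j, hy⟩
    choose f hf using hex
    have hinj : f.Injective := fun v w hvw =>
      Subtype.ext (Sum.inl_injective (hM.1.eq_of_adj_right (hf v) (hvw ▸ hf w)))
    have := Nat.card_le_card_of_injective f hinj
    rwa [Nat.card_coe_set_eq, Nat.card_eq_fintype_card, Fintype.card_fin] at this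
  have h4 := Set.ncard_add_ncard_compl N.verts
  rw [Nat.card_eq_fintype_card] at h4
  omega

/-- A new vertex outside `u` would be adjacent to all other vertices, so removing `u` would leave at
most one component. The violator condition then forces `u` to be empty and the whole order to be
odd, against `heven`. -/
theorem joinComplete_exists_isTutteViolator [Fintype V] {G : SimpleGraph V} {k : ℕ}
    (hk : 2 * matchingNum G + k < Fintype.card V) (heven : Even (Fintype.card V + k)) :
    ∃ u, (joinComplete G k).IsTutteViolator u ∧ ∀ j, .inr j ∈ u := by
  have hno : ¬ ∃ M : (joinComplete G k).Subgraph, M.IsPerfectMatching := by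
    rintro ⟨M, hM⟩
    have := card_le_of_isPerfectMatching_joinComplete hM
    omega
  rw [tutte] at hno
  push Not at hno
  obtain ⟨u, hu⟩ := hno
  refine ⟨u, hu, ?_⟩
  by_contra! hj
  obtain ⟨j, hj⟩ := hj
  have hpre : ((⊤ : (joinComplete G k).Subgraph).deleteVerts u).coe.Preconnected := by
    have key : ∀ x : ((⊤ : (joinComplete G k).Subgraph).deleteVerts u).verts,
        ((⊤ : (joinComplete G k).Subgraph).deleteVerts u).coe.Reachable x
          ⟨.inr j, trivial, hj⟩ := by
      intro x
      by_cases hx : x.1 = .inr j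
      · have : x = ⟨.inr j, trivial, hj⟩ := Subtype.ext hx
        rw [this]
      · refine Adj.reachable ?_
        have hxu := x.2.2
        simp [hxu, hj, joinComplete_adj_inr hx]
    exact fun x y => (key x).trans (key y).symm
  have hsub := hpre.subsingleton_connectedComponent
  have hle : ((⊤ : (joinComplete G k).Subgraph).deleteVerts u).coe.oddComponents.ncard ≤ 1 :=
    Set.ncard_le_one_of_subsingleton _
  have hu' := hu
  unfold IsTutteViolator at hu'
  have hu0 : u.ncard = 0 := by omega
  rw [Set.ncard_eq_zero] at hu0
  subst hu0
  have hodd := (odd_ncard_oddComponents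
    ((⊤ : (joinComplete G k).Subgraph).deleteVerts ∅).coe).1 (by
      rw [show ((⊤ : (joinComplete G k).Subgraph).deleteVerts ∅).coe.oddComponents.ncard = 1 by
        omega]
      exact odd_one)
  rw [Nat.card_coe_set_eq] at hodd
  simp only [Subgraph.deleteVerts_empty, Subgraph.verts_top, Set.ncard_univ,
    Nat.card_eq_fintype_card, Fintype.card_sum, Fintype.card_fin] at hodd
  exact Nat.not_odd_iff_even.2 heven hodd

/-- The Tutte–Berge formula. -/
theorem exists_splits_le_matchingNum [Fintype V] (G : SimpleGraph V) :
    ∃ (A : Finset V) (ι : Type) (_ : Fintype ι) (comp : V → ι), Splits G A comp ∧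
      A.card + ∑ i, (part A comp i).ncard / 2 ≤ matchingNum G := by
  classical
  -- If at most one vertex is left unmatched, the empty set with a single class already suffices.
  by_cases hn : Fintype.card V ≤ 2 * matchingNum G + 1
  · refine ⟨∅, Unit, inferInstance, fun _ => (), fun _ _ _ _ _ => rfl, ?_⟩
    have := sum_ncard_part (∅ : Finset V) (fun _ => ())
    simp only [Finset.card_empty, Finset.univ_unique, Finset.sum_singleton] at this ⊢
    omega
  -- Two fewer new vertices than the deficiency: the join has even order but still no perfect
  -- matching.
  obtain ⟨k, hk⟩ : ∃ k, Fintype.card V = 2 * matchingNum G + 2 + k :=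
    ⟨_, (Nat.add_sub_of_le (by omega)).symm⟩
  obtain ⟨u, hu, huk⟩ := joinComplete_exists_isTutteViolator (G := G) (k := k) (by omega)
    ⟨matchingNum G + 1 + k, by omega⟩
  unfold IsTutteViolator at hu
  set H := ((⊤ : (joinComplete G k).Subgraph).deleteVerts u).coe with hH
  have : Fintype H.ConnectedComponent := Fintype.ofFinite _
  let A : Finset V := {v | .inl v ∈ u}
  have hA : ∀ v, v ∈ A ↔ .inl v ∈ u := by simp [A]
  -- The value `none` occurs only on `A`, so its class outside `A` is empty.
  let comp : V → Option H.ConnectedComponent := fun v =>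
    if h : .inl v ∈ u then none else some (H.connectedComponentMk ⟨.inl v, trivial, h⟩)
  have hcomp : ∀ v (h : .inl v ∉ u),
      comp v = some (H.connectedComponentMk ⟨.inl v, trivial, h⟩) := fun v h => dif_neg h
  refine ⟨A, Option H.ConnectedComponent, inferInstance, comp, ?_, ?_⟩
  · intro v w hv hw hvw
    rw [hA] at hv hw
    rw [hcomp v hv, hcomp w hw, Option.some_inj, ConnectedComponent.eq]
    refine Adj.reachable ?_
    simp [hH, hv, hw, joinComplete_adj_inl, hvw]
  have hpart : ∀ c, (part A comp (some c)).ncard = c.supp.ncard := by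
    intro c
    have himg : c.supp = (fun v : {v // .inl v ∉ u} =>
        (⟨.inl v.1, trivial, v.2⟩ : ((⊤ : (joinComplete G k).Subgraph).deleteVerts u).verts)) ''
          {v | v.1 ∈ part A comp (some c)} := by
      ext ⟨x, hx⟩
      rcases x with v | j
      · have hv : .inl v ∉ u := hx.2
        simp only [ConnectedComponent.mem_supp_iff, Set.mem_image, part, hA, Set.mem_ofPred_eq]
        constructor
        · intro h
          exact ⟨⟨v, hv⟩, ⟨hv, by rw [hcomp v hv, h]⟩, rfl⟩
        · rintro ⟨⟨w, hw⟩, ⟨-, h⟩, heq⟩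
          obtain rfl : w = v := Sum.inl_injective (Subtype.ext_iff.1 heq)
          rw [hcomp w hw, Option.some_inj] at h
          exact h
      · exact absurd (huk j) hx.2
    rw [himg, Set.ncard_image_of_injective]
    · rw [← Set.ncard_image_of_injective _ Subtype.val_injective]
      congr 1
      ext v
      simp only [Set.mem_image, Set.mem_ofPred_eq, Subtype.exists, exists_and_left, exists_prop,
        exists_eq_right_right]
      exact ⟨fun h => ⟨h, fun h' => h.1 ((hA v).2 h')⟩, fun h => h.1⟩
    · intro v w h
      simpa [Subtype.ext_iff] using h
  have hsum := sum_ncard_part A comp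
  have hodd : H.oddComponents.ncard ≤ ∑ i, (part A comp i).ncard % 2 := by
    rw [Fintype.sum_option]
    refine le_trans ?_ (Nat.le_add_left _ _)
    rw [Set.ncard_eq_toFinset_card', Set.toFinset_ofPred, Finset.card_filter]
    refine Finset.sum_le_sum fun c _ => ?_
    rw [hpart]
    split_ifs with h
    · rw [Nat.odd_iff.1 h]
    · exact Nat.zero_le _
  have hdiv : ∑ i, (part A comp i).ncard =
      2 * ∑ i, (part A comp i).ncard / 2 + ∑ i, (part A comp i).ncard % 2 := by
    rw [Finset.mul_sum, ← Finset.sum_add_distrib]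
    exact Finset.sum_congr rfl fun i _ => (Nat.div_add_mod _ 2).symm
  have hucard : A.card + k ≤ u.ncard := by
    have : (A.disjSum (univ : Finset (Fin k)) : Set (V ⊕ Fin k)) ⊆ u := by
      rintro (v | j) hx
      · simpa [hA] using hx
      · exact huk j
    have := Set.ncard_le_ncard this (Set.toFinite _)
    rw [Set.ncard_coe_finset, Finset.card_disjSum] at this
    simpa using this
  -- With o odd classes, o ≥ |u| + 1 ≥ |A| + k + 1. Twice the left side equals |V| + |A| - o ≤ |V| -
  -- k - 1 = 2ν + 1, and parity removes the last 1.
  omega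

end TutteBerge

/-- The Chvátal–Hanson number, the largest number of edges of a graph with maximum degree below
`d` and matching number below `m`. -/
def extremalSize (d m : ℕ) : ℕ :=
  (d - 1) * (m - 1) + (d - 1) / 2 * ((m - 1) / halfCeil d)

/-! ### The Chvátal–Hanson bound and its equality case -/

section UpperBound

variable {V : Type} [Fintype V] {G : SimpleGraph V} {d m : ℕ}

theorem two_mul_numEdges_le (h : ∀ v, (G.neighborSet v).ncard < d) :
    2 * numEdges G ≤ Fintype.card V * (d - 1) := by
  rw [← sum_ncard_neighborSet]
  refine (Finset.sum_le_card_nsmul univ _ (d - 1) fun v _ => ?_).trans (by simp)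
  have := h v
  omega

theorem ncard_neighborSet_lt_card (G : SimpleGraph V) (v : V) :
    (G.neighborSet v).ncard < Fintype.card V := by
  classical
  rw [ncard_neighborSet]
  exact G.degree_lt_card_verts v

theorem numEdges_le_of_card_even {k : ℕ} (h : ∀ v, (G.neighborSet v).ncard < d)
    (hk : Fintype.card V = 2 * k) : numEdges G ≤ k * (d - 1) := by
  have := two_mul_numEdges_le h
  rw [hk, mul_assoc] at this
  omega

/-- On 2k+1 vertices the degree bound d-1 allows the bonus ⌊(d-1)/2⌋. For k < c the trivial degree
bound 2k is stronger: k(2k+1) ≤ k(d-1), since 2k+1 ≤ d-1. Even orders never get a bonus. -/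
theorem numEdges_le_of_card (h : ∀ v, (G.neighborSet v).ncard < d) :
    numEdges G ≤ Fintype.card V / 2 * (d - 1) +
      if halfCeil d ≤ Fintype.card V / 2 then (d - 1) / 2 else 0 := by
  have h1 := two_mul_numEdges_le h
  have h2 := two_mul_numEdges_le (ncard_neighborSet_lt_card G)
  rw [halfCeil_eq]
  rcases Nat.even_or_odd' (Fintype.card V) with ⟨k, hk | hk⟩
  · have := numEdges_le_of_card_even h hk
    rw [hk, Nat.mul_div_cancel_left _ two_pos]
    omega
  · have hdiv : Fintype.card V / 2 = k := by omega
    rw [hdiv]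
    rw [hk] at h1 h2
    split_ifs with hc
    · rw [add_mul, one_mul, mul_assoc] at h1
      omega
    · have : (2 * k + 1) * (2 * k + 1 - 1) ≤ 2 * (k * (d - 1)) := by
        rw [Nat.add_sub_cancel, mul_comm, mul_assoc]
        exact Nat.mul_le_mul_left _ (Nat.mul_le_mul_left _ (by omega))
      omega

theorem ncard_neighborSet_induce_le (G : SimpleGraph V) (s : Set V) (v : s) :
    ((G.induce s).neighborSet v).ncard ≤ (G.neighborSet v).ncard := by
  rw [← Set.ncard_image_of_injective _ Subtype.val_injective]
  refine Set.ncard_le_ncard ?_ (Set.toFinite _)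
  rintro _ ⟨w, hw, rfl⟩
  exact hw

theorem numEdges_induce_le (h : ∀ v, (G.neighborSet v).ncard < d) (s : Set V) :
    numEdges (G.induce s) ≤ s.ncard / 2 * (d - 1) +
      if halfCeil d ≤ s.ncard / 2 then (d - 1) / 2 else 0 := by
  classical
  have := numEdges_le_of_card (G := G.induce s) (d := d) fun v =>
    (ncard_neighborSet_induce_le G s v).trans_lt (h v)
  rwa [← Nat.card_eq_fintype_card, Nat.card_coe_set_eq] at this

theorem card_filter_mul_le {ι : Type} [Fintype ι] (k : ι → ℕ) (c : ℕ) :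
    #{i | c ≤ k i} * c ≤ ∑ i, k i := by
  refine le_trans ?_ (Finset.sum_le_sum_of_subset (filter_subset (fun i => c ≤ k i) univ))
  rw [← smul_eq_mul]
  exact Finset.card_nsmul_le_sum _ _ _ fun i hi => (mem_filter.1 hi).2

theorem sum_ncard_neighborSet_le {V : Type} {G : SimpleGraph V} {d : ℕ}
    (h : ∀ v, (G.neighborSet v).ncard < d) (A : Finset V) :
    ∑ a ∈ A, (G.neighborSet a).ncard ≤ A.card * (d - 1) := by
  rw [← smul_eq_mul]
  refine Finset.sum_le_card_nsmul _ _ _ fun v _ => ?_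
  have := h v
  omega

theorem sum_part_bound {ι : Type} [Fintype ι] (k : ι → ℕ) (c x b : ℕ) :
    ∑ i, (k i * x + if c ≤ k i then b else 0) = (∑ i, k i) * x + #{i | c ≤ k i} * b := by
  rw [Finset.sum_add_distrib, Finset.sum_mul, ← Finset.sum_filter, Finset.sum_const, smul_eq_mul]

/-- The upper bound of Chvátal and Hanson. -/
theorem numEdges_le_extremalSize (hd : 2 ≤ d) (h : maxDeg G < d) (hm : matchingNum G < m) :
    numEdges G ≤ extremalSize d m := by
  classical
  rw [maxDeg_lt_iff (by omega)] at h
  obtain ⟨A, ι, _, comp, hs, hν⟩ := exists_splits_le_matchingNum G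
  have hc : 0 < halfCeil d := by rw [halfCeil_eq]; omega
  have h1 := (numEdges_le_of_splits hs).trans (add_le_add (sum_ncard_neighborSet_le h A)
    (Finset.sum_le_sum fun i _ => numEdges_induce_le h (part A comp i)))
  rw [sum_part_bound (fun i => (part A comp i).ncard / 2), ← add_assoc, ← add_mul] at h1
  refine h1.trans ?_
  rw [extremalSize, mul_comm (d - 1), mul_comm ((d - 1) / 2)]
  refine add_le_add (Nat.mul_le_mul_right _ (by omega)) (Nat.mul_le_mul_right _ ?_)
  -- It remains to count the classes with a bonus: each consumes at least c of the budget m-1.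
  rw [Nat.le_div_iff_mul_le hc]
  have := card_filter_mul_le (fun i => (part A comp i).ncard / 2) (halfCeil d)
  omega

/-- Truncating each `k i` to c or 0 can only lower the sum; under the hypothesis it does not, so
equality holds term by term. -/
theorem eq_of_sum_le_card_mul {ι : Type} [Fintype ι] {k : ι → ℕ} {c : ℕ}
    (h : ∑ i, k i ≤ #{i | c ≤ k i} * c) (i : ι) : k i = if c ≤ k i then c else 0 := by
  have hle : ∀ i ∈ univ, (if c ≤ k i then c else 0) ≤ k i := fun i _ => by
    split_ifs with h
    · exact h
    · exact Nat.zero_le _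
  have heq : ∑ i, (if c ≤ k i then c else 0) = ∑ i, k i := by
    refine le_antisymm (Finset.sum_le_sum hle) ?_
    rwa [← Finset.sum_filter, Finset.sum_const, smul_eq_mul]
  exact ((Finset.sum_eq_sum_iff_of_le hle).1 heq i (mem_univ i)).symm

/-- If equality holds in the upper bound and `⌈(d - 1) / 2⌉` divides `m - 1`, then the graph splits
into parts with `2 * ⌈(d - 1) / 2⌉ + 1` vertices and the largest possible number of edges. -/
theorem exists_parts_of_numEdges_eq (hd : 3 ≤ d) (h : maxDeg G < d) (hm : matchingNum G < m)
    (hdvd : halfCeil d ∣ m - 1) (hiso : ∀ v, ∃ w, G.Adj v w)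
    (hE : numEdges G = extremalSize d m) :
    ∃ (ι : Type) (_ : Fintype ι) (comp : V → ι), (∀ ⦃v w⦄, G.Adj v w → comp v = comp w) ∧
      Fintype.card ι = (m - 1) / halfCeil d ∧ ∀ i, (comp ⁻¹' {i}).ncard = 2 * halfCeil d + 1 ∧
        numEdges (G.induce (comp ⁻¹' {i})) = (2 * halfCeil d + 1) * (d - 1) / 2 := by
  classical
  rw [maxDeg_lt_iff (by omega)] at h
  obtain ⟨A, ι, _, comp, hs, hν⟩ := exists_splits_le_matchingNum G
  have hc : 0 < halfCeil d := by rw [halfCeil_eq]; omega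
  have hb : 0 < (d - 1) / 2 := by omega
  obtain ⟨q, hq⟩ := hdvd
  have h0 := Finset.sum_le_sum fun i (_ : i ∈ univ) => numEdges_induce_le h (part A comp i)
  have h1 := (numEdges_le_of_splits hs).trans
    (add_le_add_left (sum_ncard_neighborSet_le h A) _)
  have h2 := card_filter_mul_le (fun i => (part A comp i).ncard / 2) (halfCeil d)
  have h3 := eq_of_sum_le_card_mul (k := fun i => (part A comp i).ncard / 2) (c := halfCeil d)
  have h4 := sum_part_bound (fun i => (part A comp i).ncard / 2) (halfCeil d) (d - 1) ((d - 1) / 2)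
  rw [h4] at h0
  have hm1 : m - 1 = halfCeil d * q := hq
  rw [hE, extremalSize, hm1, Nat.mul_div_cancel_left _ hc] at h1
  rw [hm1, Nat.mul_div_cancel_left _ hc]
  set c := halfCeil d
  set T := #{i | c ≤ (part A comp i).ncard / 2} with hT
  set S := ∑ i, (part A comp i).ncard / 2 with hS
  have hAS : A.card + S ≤ c * q := by omega
  have hTq : T ≤ q := by
    refine Nat.le_of_mul_le_mul_right (h2.trans ?_) hc
    rw [mul_comm]
    omega
  -- The bonus is positive because d ≥ 3, so reaching the bound requires all q bonuses.
  have hqT : q ≤ T := by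
    have hx : (d - 1) * (c * q) + (d - 1) / 2 * q ≤ (d - 1) * (c * q) + (d - 1) / 2 * T := by
      calc _ ≤ _ := h1
        _ ≤ A.card * (d - 1) + (S * (d - 1) + T * ((d - 1) / 2)) := Nat.add_le_add_left h0 _
        _ = (d - 1) * (A.card + S) + (d - 1) / 2 * T := by ring
        _ ≤ _ := Nat.add_le_add_right (Nat.mul_le_mul_left _ hAS) _
    exact Nat.le_of_mul_le_mul_left (Nat.le_of_add_le_add_left hx) hb
  obtain rfl : T = q := le_antisymm hTq hqT
  have hcT : c * T = T * c := mul_comm _ _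
  -- The q large classes exhaust the whole budget, so nothing is left for `A` or for a larger class.
  have hA0 : A.card = 0 := by omega
  have hSc : S = T * c := by omega
  have h5 := h3 (by omega)
  have hAe : A = ∅ := Finset.card_eq_zero.1 hA0
  have hpart : ∀ i, part A comp i = comp ⁻¹' {i} := fun i => by
    ext v
    simp [part, hAe]
  have h6 := (Finset.sum_eq_sum_iff_of_le fun i (_ : i ∈ univ) =>
    numEdges_induce_le h (part A comp i)).1 (le_antisymm (Finset.sum_le_sum fun i _ =>
      numEdges_induce_le h (part A comp i)) (by
      rw [h4]
      refine le_trans (le_of_eq ?_) (h1.trans (le_of_eq ?_))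
      · rw [hSc]
        ring
      · rw [hA0, zero_mul, zero_add]))
  have hadj : ∀ ⦃v w⦄, G.Adj v w → comp v = comp w := fun v w hvw =>
    hs (by simp [hAe]) (by simp [hAe]) hvw
  -- A nonempty class that is not large has a single vertex, which would be isolated as `A` is
  -- empty. Hence the large classes are exactly the nonempty ones.
  have hbig : ∀ i, c ≤ (comp ⁻¹' {i}).ncard / 2 ↔ ∃ v, comp v = i := by
    intro i
    constructor
    · intro hi
      obtain ⟨v, hv⟩ := Set.nonempty_of_ncard_ne_zero (s := comp ⁻¹' {i}) (by omega)
      exact ⟨v, hv⟩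
    · rintro ⟨v, rfl⟩
      by_contra hlt
      have h7 := h5 (comp v)
      simp only [hpart, if_neg hlt] at h7
      obtain ⟨w, hw⟩ := hiso v
      have hone : (comp ⁻¹' {comp v}).ncard ≤ 1 := by omega
      rw [Set.ncard_le_one] at hone
      exact hw.ne (hone v rfl w (hadj hw).symm)
  refine ⟨{i // ∃ v, comp v = i}, inferInstance, fun v => ⟨comp v, v, rfl⟩,
    fun v w hvw => Subtype.ext (hadj hvw), ?_, ?_⟩
  · rw [Fintype.card_subtype, hT]
    simp_rw [hpart, hbig]
  · rintro ⟨i, hi⟩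
    have hpre : (fun v => (⟨comp v, v, rfl⟩ : {i // ∃ v, comp v = i})) ⁻¹' {⟨i, hi⟩} =
        comp ⁻¹' {i} := by
      ext v
      simp
    rw [hpre]
    have h7 := h5 i
    have h8 := h6 i (mem_univ i)
    rw [hpart i] at h7 h8
    rw [if_pos ((hbig i).2 hi)] at h7 h8
    rw [h7] at h8
    constructor
    -- Half-size c still allows 2c vertices, but an even order gets no bonus and misses the edge
    -- count.
    · by_contra hne
      have heven : Fintype.card ↥(comp ⁻¹' {i}) = 2 * c := by
        rw [← Nat.card_eq_fintype_card, Nat.card_coe_set_eq]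
        omega
      have := numEdges_le_of_card_even (G := G.induce (comp ⁻¹' {i})) (d := d)
        (fun v => (ncard_neighborSet_induce_le G _ v).trans_lt (h v)) heven
      omega
    · rw [h8, add_mul, one_mul, mul_assoc]
      omega

end UpperBound

/-! ### Recognising disjoint unions and the graph C -/

section Isomorphisms

/-- A graph in which every vertex has exactly one neighbour is a disjoint union of edges, and any
given vertex can be placed first in any given edge. -/
theorem exists_iso_copies_complete_two {W : Type} [Fintype W] {H : SimpleGraph W}
    (hH : ∀ v, ∃! w, H.Adj v w) {k : ℕ} (hk : Fintype.card W = 2 * k) (x : W) (i : Fin k) :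
    ∃ e : H ≃g copies k (complete 2), e x = (i, 0) := by
  classical
  choose p hp hp' using hH
  have hpp : ∀ v, p (p v) = v := fun v => (hp' (p v) v (hp v).symm).symm
  have hcard : Fintype.card H.edgeSet = k := by
    have h1 := sum_ncard_neighborSet H
    have h2 : ∀ v, (H.neighborSet v).ncard = 1 := fun v =>
      Set.ncard_eq_one.2 ⟨p v, Set.ext fun w => ⟨fun h => hp' v w h, fun h => h ▸ hp v⟩⟩
    simp only [h2, Finset.sum_const, Finset.card_univ, hk, smul_eq_mul] at h1
    rw [← Nat.card_eq_fintype_card, Nat.card_coe_set_eq]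
    change _ = 2 * H.edgeSet.ncard at h1
    omega
  let E : W → H.edgeSet := fun v => ⟨s(v, p v), hp v⟩
  have hE : ∀ v w, E v = E w ↔ w = v ∨ w = p v := by
    intro v w
    rw [Subtype.ext_iff, show (E v).1 = s(v, p v) from rfl, show (E w).1 = s(w, p w) from rfl,
      Sym2.eq_iff]
    constructor
    · rintro (⟨rfl, -⟩ | ⟨-, rfl⟩)
      · exact Or.inl rfl
      · exact Or.inr rfl
    · rintro (rfl | rfl)
      · exact Or.inl ⟨rfl, rfl⟩
      · exact Or.inr ⟨(hpp v).symm, rfl⟩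
  obtain ⟨σ, hσ⟩ : ∃ σ : H.edgeSet ≃ Fin k, σ (E x) = i := by
    let τ : H.edgeSet ≃ Fin k := Fintype.equivOfCardEq (by simpa using hcard)
    exact ⟨τ.trans (Equiv.swap (τ (E x)) i), by simp⟩
  -- Choose the end of each edge that receives second coordinate 0; on the edge through `x` it must
  -- be `x`.
  obtain ⟨hd, hhd, hx⟩ : ∃ hd : H.edgeSet → W, (∀ e, hd e ∈ e.1) ∧ hd (E x) = x := by
    refine ⟨fun e => if x ∈ e.1 then x else e.1.out.1, fun e => ?_, ?_⟩
    · dsimp only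
      split_ifs with h
      · exact h
      · exact Sym2.out_fst_mem _
    · simp [E]
  let f : W → Fin k × Fin 2 := fun v => (σ (E v), if v = hd (E v) then 0 else 1)
  have hf : f.Injective := by
    intro v w hvw
    obtain ⟨h1, h2⟩ := Prod.mk.inj hvw
    have h3 := σ.injective h1
    rcases (hE v w).1 h3 with rfl | rfl
    · rfl
    · have h4 : hd (E v) = v ∨ hd (E v) = p v := Sym2.mem_iff.1 (hhd (E v))
      rw [← h3] at h2
      rcases h4 with h4 | h4 <;> rw [h4] at h2
      · by_contra hne
        rw [if_pos rfl, if_neg (Ne.symm hne)] at h2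
        exact absurd h2 (by decide)
      · by_contra hne
        rw [if_neg hne, if_pos rfl] at h2
        exact absurd h2 (by decide)
  have hbij : f.Bijective := (Fintype.bijective_iff_injective_and_card f).2
    ⟨hf, by simp [hk, mul_comm]⟩
  refine ⟨⟨Equiv.ofBijective f hbij, fun {v w} => ?_⟩, ?_⟩
  · change ((f v).1 = (f w).1 ∧ (f v).2 ≠ (f w).2) ↔ H.Adj v w
    have h1 : (f v).1 = (f w).1 ↔ w = v ∨ w = p v := by rw [← hE, ← σ.apply_eq_iff_eq]
    constructor
    · rintro ⟨ha, hb⟩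
      rcases h1.1 ha with rfl | rfl
      · exact absurd rfl hb
      · exact hp v
    · intro h
      have h2 := h1.2 (Or.inr (hp' v w h))
      exact ⟨h2, fun hb => h.ne (hf (Prod.ext h2 hb))⟩
  · change f x = (i, 0)
    simp only [f, hσ, hx, if_true]

/-- A graph that splits into `q` parts isomorphic to `H` is a disjoint union of copies of `H`. -/
theorem nonempty_iso_copies {V U ι : Type} [Fintype ι] {G : SimpleGraph V} {H : SimpleGraph U}
    {comp : V → ι} {q : ℕ} (hcomp : ∀ ⦃v w⦄, G.Adj v w → comp v = comp w)
    (hq : Fintype.card ι = q) (h : ∀ i, Nonempty (G.induce (comp ⁻¹' {i}) ≃g H)) :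
    Nonempty (G ≃g copies q H) := by
  classical
  let φ := fun i => (h i).some
  let σ : ι ≃ Fin q := Fintype.equivFinOfCardEq hq
  let f : V → Fin q × U := fun v => (σ (comp v), φ (comp v) ⟨v, rfl⟩)
  have hφ : ∀ v i (hi : comp v = i), φ (comp v) ⟨v, rfl⟩ = φ i ⟨v, hi⟩ := by
    rintro v _ rfl
    rfl
  have hbij : f.Bijective := by
    constructor
    · intro v w hvw
      obtain ⟨h1, h2⟩ := Prod.mk.inj hvw
      have h3 := σ.injective h1
      rw [hφ v _ h3] at h2
      exact congrArg Subtype.val ((φ (comp w)).injective h2)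
    · rintro ⟨j, u⟩
      refine ⟨((φ (σ.symm j)).symm u).1, ?_⟩
      have h1 : comp ((φ (σ.symm j)).symm u).1 = σ.symm j := ((φ (σ.symm j)).symm u).2
      refine Prod.ext ?_ ?_
      · simp [f, h1]
      · change φ (comp _) _ = u
        rw [hφ _ _ h1]
        exact (φ (σ.symm j)).apply_symm_apply u
  refine ⟨⟨Equiv.ofBijective f hbij, fun {v w} => ?_⟩⟩
  change (σ (comp v) = σ (comp w) ∧ H.Adj (φ (comp v) ⟨v, rfl⟩) (φ (comp w) ⟨w, rfl⟩)) ↔ _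
  rw [σ.apply_eq_iff_eq]
  constructor
  · rintro ⟨h1, h2⟩
    rw [hφ v _ h1, (φ (comp w)).map_adj_iff] at h2
    exact h2
  · intro hvw
    have h1 := hcomp hvw
    refine ⟨h1, ?_⟩
    rw [hφ v _ h1, (φ (comp w)).map_adj_iff]
    exact hvw

/-- A graph on `2j + 1` vertices whose complement has one vertex of degree two while the other
vertices have degree one is isomorphic to `evenC j`. -/
theorem nonempty_iso_evenC {V : Type} [Fintype V] {G : SimpleGraph V} {j : ℕ} (hj : 0 < j)
    (hcard : Fintype.card V = 2 * j + 1) {x : V} (hx : (Gᶜ.neighborSet x).ncard = 2)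
    (hne : ∀ v, v ≠ x → (Gᶜ.neighborSet v).ncard = 1) : Nonempty (G ≃g evenC j) := by
  classical
  obtain ⟨y, z, hyz, hxyz⟩ := Set.ncard_eq_two.1 hx
  have hxn : ∀ w, Gᶜ.Adj x w ↔ w = y ∨ w = z := fun w => by
    rw [← mem_neighborSet, hxyz]
    simp
  have hxy : Gᶜ.Adj x y := (hxn y).2 (Or.inl rfl)
  have hyn : ∀ w, Gᶜ.Adj y w ↔ w = x := by
    obtain ⟨a, ha⟩ := Set.ncard_eq_one.1 (hne y hxy.ne')
    have hxa : x ∈ Gᶜ.neighborSet y := hxy.symm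
    rw [ha] at hxa
    obtain rfl : x = a := hxa
    intro w
    rw [← mem_neighborSet, ha]
    rfl
  -- The complement is the path `y`–`x`–`z` together with disjoint edges, so deleting the end `y`
  -- leaves a perfect matching of it. In `evenC` the vertex `y` becomes `none`, and `x`, its only
  -- non-neighbour, becomes 0.
  have hreg : ∀ v : {v // v ≠ y}, ∃! w, (Gᶜ.comap ((↑) : {v // v ≠ y} → V)).Adj v w := by
    rintro ⟨v, hv⟩
    by_cases hvx : v = x
    · subst hvx
      refine ⟨⟨z, hyz.symm⟩, (hxn z).2 (Or.inr rfl), ?_⟩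
      rintro ⟨w, hw⟩ h
      exact Subtype.ext (((hxn w).1 h).resolve_left hw)
    · obtain ⟨a, ha⟩ := Set.ncard_eq_one.1 (hne v hvx)
      have hva : Gᶜ.Adj v a := by
        rw [← mem_neighborSet, ha]
        rfl
      refine ⟨⟨a, ?_⟩, hva, ?_⟩
      · rintro rfl
        exact hvx ((hyn v).1 hva.symm)
      · rintro ⟨w, hw⟩ h
        have h' : w ∈ Gᶜ.neighborSet v := h
        rw [ha] at h'
        exact Subtype.ext h'
  obtain ⟨e, he⟩ := exists_iso_copies_complete_two hreg (k := j)
    (by rw [Fintype.card_subtype_compl, Fintype.card_subtype_eq, hcard, Nat.add_sub_cancel])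
    ⟨x, hxy.ne⟩ ⟨0, hj⟩
  -- Sending (i, b) to 2i + b makes halving recover the index of the removed edge.
  let g : Fin j × Fin 2 ≃ Fin (2 * j) := finProdFinEquiv.trans (finCongr (mul_comm j 2))
  have hg : ∀ a, (g a).val = a.2.val + 2 * a.1.val := fun a => rfl
  have key : ∀ a b : {v // v ≠ y},
      (g (e a)).val / 2 ≠ (g (e b)).val / 2 ↔ G.Adj a b := by
    intro a b
    have h1 : Gᶜ.Adj a b ↔ (copies j (complete 2)).Adj (e a) (e b) := e.map_adj_iff.symm
    have h2 : G.Adj a b ↔ a ≠ b ∧ ¬ Gᶜ.Adj a b := by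
      rw [compl_adj]
      constructor
      · intro h
        exact ⟨fun h' => h.ne (congrArg _ h'), fun h' => h'.2 h⟩
      · rintro ⟨ha, hb⟩
        by_contra hc
        exact hb ⟨fun h' => ha (Subtype.ext h'), hc⟩
    have h3 : a = b ↔ (e a) = (e b) := e.injective.eq_iff.symm
    rw [h2, h1, Ne, Ne, h3, hg, hg]
    obtain ⟨a1, a2⟩ := e a
    obtain ⟨b1, b2⟩ := e b
    simp only [copies, Prod.mk.injEq, top_adj, Fin.ext_iff]
    have := a2.isLt
    have := b2.isLt
    omega
  have key0 : ∀ a : {v // v ≠ y}, (g (e a)).val ≠ 0 ↔ G.Adj y a := by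
    intro a
    have h2 : G.Adj y a ↔ a.1 ≠ x := by
      rw [Ne, ← hyn, compl_adj]
      have := a.2
      constructor
      · intro h h'
        exact h'.2 h
      · intro h
        by_contra hc
        exact h ⟨this.symm, hc⟩
    have h3 : a.1 = x ↔ e a = (⟨0, hj⟩, 0) := by
      rw [← he, e.injective.eq_iff, Subtype.ext_iff]
    rw [h2, Ne, Ne, h3, hg]
    obtain ⟨a1, a2⟩ := e a
    simp only [Prod.mk.injEq, Fin.ext_iff, Fin.val_zero]
    omega
  let θ : Option {v // v ≠ y} ≃ Option (Fin (2 * j)) := Equiv.optionCongr (e.toEquiv.trans g)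
  refine ⟨(⟨(Equiv.optionSubtypeNe y).symm.trans θ, fun {v w} => ?_⟩ : G ≃g evenC j)⟩
  obtain ⟨a, rfl⟩ := (Equiv.optionSubtypeNe y).surjective v
  obtain ⟨b, rfl⟩ := (Equiv.optionSubtypeNe y).surjective w
  simp only [Equiv.trans_apply, Equiv.symm_apply_apply]
  rcases a with _ | a <;> rcases b with _ | b
  · simp [θ, evenC]
  · simpa [θ, evenC] using key0 b
  · simpa [θ, evenC, adj_comm] using key0 a
  · simpa [θ, evenC] using key a b

/-- The graph `C` is determined by its numbers of vertices and edges and by the degree bound. -/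
theorem nonempty_iso_graphC {V : Type} [Fintype V] {G : SimpleGraph V} {d : ℕ} (hd : 2 ≤ d)
    (hcard : Fintype.card V = 2 * halfCeil d + 1) (hdeg : ∀ v, (G.neighborSet v).ncard < d)
    (hE : numEdges G = (2 * halfCeil d + 1) * (d - 1) / 2) : Nonempty (G ≃g graphC d) := by
  classical
  have hsum := sum_ncard_neighborSet G
  rw [hE] at hsum
  have hc : halfCeil d = d / 2 := halfCeil_eq d
  have hcompl : ∀ v, (Gᶜ.neighborSet v).ncard + (G.neighborSet v).ncard = 2 * halfCeil d := by
    intro v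
    rw [ncard_neighborSet, ncard_neighborSet, degree_compl, hcard]
    have := G.degree_lt_card_verts v
    omega
  rw [graphC]
  split_ifs with hodd
  · have hd1 : d - 1 = 2 * halfCeil d := by
      obtain ⟨k, rfl⟩ := hodd
      omega
    have hval : 2 * ((2 * halfCeil d + 1) * (d - 1) / 2) = Fintype.card V * (d - 1) := by
      rw [hcard]
      refine Nat.mul_div_cancel' (Dvd.dvd.mul_left ?_ _)
      rw [hd1]
      exact dvd_mul_right _ _
    rw [hval] at hsum
    -- For odd d the degree sum equals its maximum (2c+1)(d-1), so every degree is d-1 = 2c.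
    have hall : ∀ v, (G.neighborSet v).ncard = d - 1 := by
      have hle : ∀ v ∈ univ, (G.neighborSet v).ncard ≤ d - 1 := fun v _ => by
        have := hdeg v
        omega
      have := (Finset.sum_eq_sum_iff_of_le hle).1 (by rw [hsum]; simp)
      exact fun v => this v (mem_univ v)
    have htop : G = ⊤ := by
      ext v w
      rw [top_adj]
      refine ⟨fun h => h.ne, fun hvw => ?_⟩
      by_contra hadj
      have h0 := hcompl v
      rw [hall v, hd1] at h0
      have : (Gᶜ.neighborSet v).ncard = 0 := by omega
      rw [Set.ncard_eq_zero] at this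
      have hw : w ∈ Gᶜ.neighborSet v := ⟨hvw, hadj⟩
      rw [this] at hw
      exact hw
    subst htop
    exact ⟨Iso.completeGraph (Fintype.equivOfCardEq (by rw [hcard]; simp))⟩
  · have heven : d = 2 * halfCeil d := by
      rw [Nat.not_odd_iff_even] at hodd
      obtain ⟨k, rfl⟩ := hodd
      omega
    set c := halfCeil d
    have h1 : ∀ v, 1 ≤ (Gᶜ.neighborSet v).ncard := fun v => by
      have := hcompl v
      have := hdeg v
      omega
    have h2 : ∑ v, (Gᶜ.neighborSet v).ncard + ∑ v, (G.neighborSet v).ncard =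
        (2 * c + 1) * (2 * c) := by
      rw [← Finset.sum_add_distrib]
      simp [hcompl, hcard]
    have h3 : ∑ v, ((Gᶜ.neighborSet v).ncard - 1) + (2 * c + 1) =
        ∑ v, (Gᶜ.neighborSet v).ncard := by
      have : ∑ v : V, 1 = 2 * c + 1 := by simp [hcard]
      rw [← this, ← Finset.sum_add_distrib]
      exact Finset.sum_congr rfl fun v _ => Nat.sub_add_cancel (h1 v)
    -- For even d the product (2c+1)(d-1) is odd, so rounding loses exactly one in the degree sum.
    -- All complement degrees are at least 1 and their total excess is 1.
    have h4 : ∑ v, ((Gᶜ.neighborSet v).ncard - 1) = 1 := by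
      obtain ⟨t, ht⟩ : ∃ t, c = t + 1 := ⟨c - 1, by omega⟩
      have hd1 : d - 1 = 2 * t + 1 := by omega
      rw [hsum, hd1, ht] at h2
      rw [ht] at h3
      have e1 : (2 * (t + 1) + 1) * (2 * t + 1) = 2 * (2 * (t * t) + 4 * t + 1) + 1 := by ring
      have e2 : (2 * (t + 1) + 1) * (2 * (t + 1)) = 4 * (t * t) + 10 * t + 6 := by ring
      rw [e1, e2] at h2
      omega
    obtain ⟨x, hx0, hx'⟩ : ∃ x, (Gᶜ.neighborSet x).ncard - 1 ≠ 0 ∧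
        ∀ v, v ≠ x → (Gᶜ.neighborSet v).ncard - 1 = 0 := by
      obtain ⟨x, -, hx⟩ := Finset.exists_ne_zero_of_sum_ne_zero (h4.trans_ne one_ne_zero)
      have h5 := Finset.add_sum_erase univ (fun v => (Gᶜ.neighborSet v).ncard - 1) (mem_univ x)
      have h6 : ∑ v ∈ univ.erase x, ((Gᶜ.neighborSet v).ncard - 1) = 0 := by omega
      rw [Finset.sum_eq_zero_iff] at h6
      exact ⟨x, hx, fun v hv => h6 v (by simp [hv])⟩
    have hx : (Gᶜ.neighborSet x).ncard - 1 = 1 := by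
      exact (Finset.sum_eq_single x (fun v _ hv => hx' v hv)
        fun h => absurd (mem_univ x) h).symm.trans h4
    refine nonempty_iso_evenC (by omega) hcard (x := x) ?_ ?_
    · have := h1 x
      omega
    · intro v hv
      have := h1 v
      have := hx' v hv
      omega

end Isomorphisms

/-! ### Graphs attaining the bound -/

section Constructions

variable {V W : Type}

theorem ncard_neighborSet_copies (n : ℕ) (G : SimpleGraph V) (x : Fin n × V) :
    ((copies n G).neighborSet x).ncard = (G.neighborSet x.2).ncard := by
  have : (copies n G).neighborSet x = Prod.mk x.1 '' G.neighborSet x.2 := by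
    ext ⟨j, w⟩
    simp only [mem_neighborSet, copies, Set.mem_image, Prod.mk.injEq]
    constructor
    · rintro ⟨h1, h2⟩
      exact ⟨w, h2, h1, rfl⟩
    · rintro ⟨w, h, h1, rfl⟩
      exact ⟨h1, h⟩
  rw [this, Set.ncard_image_of_injective _ (Prod.mk_right_injective _)]

theorem ncard_neighborSet_sum_inl (G : SimpleGraph V) (H : SimpleGraph W) (v : V) :
    ((G ⊕g H).neighborSet (.inl v)).ncard = (G.neighborSet v).ncard := by
  rw [neighborSet_sum_inl, Set.ncard_image_of_injective _ Sum.inl_injective]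

theorem ncard_neighborSet_sum_inr (G : SimpleGraph V) (H : SimpleGraph W) (w : W) :
    ((G ⊕g H).neighborSet (.inr w)).ncard = (H.neighborSet w).ncard := by
  rw [neighborSet_sum_inr, Set.ncard_image_of_injective _ Sum.inr_injective]

variable [Fintype V] [Fintype W]

theorem numEdges_copies (n : ℕ) (G : SimpleGraph V) :
    numEdges (copies n G) = n * numEdges G := by
  have h := sum_ncard_neighborSet (copies n G)
  simp only [ncard_neighborSet_copies, Fintype.sum_prod_type, sum_ncard_neighborSet,
    Finset.sum_const, Finset.card_univ, Fintype.card_fin, smul_eq_mul] at h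
  rw [mul_left_comm] at h
  omega

theorem numEdges_sum (G : SimpleGraph V) (H : SimpleGraph W) :
    numEdges (G ⊕g H) = numEdges G + numEdges H := by
  have h := sum_ncard_neighborSet (G ⊕g H)
  rw [Fintype.sum_sum_type] at h
  simp only [ncard_neighborSet_sum_inl, ncard_neighborSet_sum_inr, sum_ncard_neighborSet] at h
  omega

/-- A Tutte–Berge certificate for `G`, repeated in every copy, certifies the bound for the union. -/
theorem matchingNum_copies_le (n : ℕ) (G : SimpleGraph V) :
    matchingNum (copies n G) ≤ n * matchingNum G := by
  classical
  obtain ⟨A, ι, _, comp, hs, hν⟩ := exists_splits_le_matchingNum G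
  have hs' : Splits (copies n G) (univ ×ˢ A) (Prod.map id comp) := by
    rintro ⟨i, v⟩ ⟨j, w⟩ hv hw ⟨h1, h2⟩
    simp only [mem_product, mem_univ, true_and] at hv hw
    exact Prod.ext h1 (hs hv hw h2)
  have hpart : ∀ i t, part (univ ×ˢ A) (Prod.map (id : Fin n → Fin n) comp) (i, t) =
      Prod.mk i '' part A comp t := by
    intro i t
    ext ⟨j, w⟩
    simp only [part, mem_product, mem_univ, true_and, Prod.map_apply, id, Prod.mk.injEq,
      Set.mem_ofPred_eq, Set.mem_image]
    constructor
    · rintro ⟨h1, h2, h3⟩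
      exact ⟨w, ⟨h1, h3⟩, h2.symm, rfl⟩
    · rintro ⟨w, ⟨h1, h2⟩, h3, rfl⟩
      exact ⟨h1, h3.symm, h2⟩
  have h := matchingNum_le_of_splits hs'
  simp only [Fintype.sum_prod_type, hpart, card_product, Finset.sum_const,
    Set.ncard_image_of_injective _ (Prod.mk_right_injective _), Finset.card_univ,
    Fintype.card_fin, smul_eq_mul] at h
  rw [← mul_add] at h
  exact h.trans (Nat.mul_le_mul_left _ hν)

theorem matchingNum_sum_le (G : SimpleGraph V) (H : SimpleGraph W) :
    matchingNum (G ⊕g H) ≤ matchingNum G + matchingNum H := by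
  classical
  obtain ⟨A, ι, _, f, hs, hν⟩ := exists_splits_le_matchingNum G
  obtain ⟨B, κ, _, g, ht, hμ⟩ := exists_splits_le_matchingNum H
  have hs' : Splits (G ⊕g H) (A.disjSum B) (Sum.map f g) := by
    rintro (v | v) (w | w) hv hw h
    · exact congrArg Sum.inl (hs (by simpa using hv) (by simpa using hw) h)
    · simp at h
    · simp at h
    · exact congrArg Sum.inr (ht (by simpa using hv) (by simpa using hw) h)
  have h1 : ∀ i, part (A.disjSum B) (Sum.map f g) (.inl i) = Sum.inl '' part A f i := by
    intro i
    ext (v | v) <;> simp [part]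
  have h2 : ∀ i, part (A.disjSum B) (Sum.map f g) (.inr i) = Sum.inr '' part B g i := by
    intro i
    ext (v | v) <;> simp [part]
  have h := matchingNum_le_of_splits hs'
  simp only [Fintype.sum_sum_type, h1, h2, card_disjSum,
    Set.ncard_image_of_injective _ Sum.inl_injective,
    Set.ncard_image_of_injective _ Sum.inr_injective] at h
  omega

/-- Outside a vertex cover all classes may be taken to be single vertices, which contribute nothing.
-/
theorem matchingNum_le_of_cover {G : SimpleGraph V} {A : Finset V}
    (h : ∀ v w, G.Adj v w → v ∈ A ∨ w ∈ A) : matchingNum G ≤ A.card := by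
  have hs : Splits G A id := fun v w hv hw hvw => absurd (h v w hvw) (by simp [hv, hw])
  refine (matchingNum_le_of_splits hs).trans ?_
  have : ∀ i, (part A id i).ncard / 2 = 0 := by
    intro i
    have : (part A id i).ncard ≤ 1 := by
      rw [Set.ncard_le_one]
      rintro a ⟨-, rfl⟩ b ⟨-, h⟩
      exact h.symm
    omega
  simp [this]

/-- Bounds the number of edges from below by listing the non-edges. Only the size of the list
matters, so superfluous or repeated entries are harmless. -/
theorem card_mul_le_of_nonadj_mem {G : SimpleGraph V} {S : Finset (Sym2 V)}
    (h : ∀ v w, v ≠ w → ¬ G.Adj v w → s(v, w) ∈ S) :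
    Fintype.card V * (Fintype.card V - 1) ≤ 2 * (numEdges G + S.card) := by
  classical
  have h1 : numEdges Gᶜ ≤ S.card := by
    rw [numEdges, ← Set.ncard_coe_finset]
    refine Set.ncard_le_ncard ?_ (Set.toFinite _)
    intro e he
    induction e with | _ v w
    exact h v w he.1 he.2
  have h2 : ∀ v, (G.neighborSet v).ncard + (Gᶜ.neighborSet v).ncard = Fintype.card V - 1 := by
    intro v
    rw [ncard_neighborSet, ncard_neighborSet, degree_compl]
    have := G.degree_lt_card_verts v
    omega
  have h3 : ∑ v, (G.neighborSet v).ncard + ∑ v, (Gᶜ.neighborSet v).ncard =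
      Fintype.card V * (Fintype.card V - 1) := by
    rw [← Finset.sum_add_distrib]
    simp [h2]
  rw [sum_ncard_neighborSet, sum_ncard_neighborSet] at h3
  omega

theorem ncard_neighborSet_add_card_le {G : SimpleGraph V} {v : V} {T : Finset V}
    (h : ∀ w ∈ T, ¬ G.Adj v w) : (G.neighborSet v).ncard + T.card ≤ Fintype.card V := by
  classical
  have h1 := Set.ncard_add_ncard_compl (G.neighborSet v)
  have h2 : T.card ≤ (G.neighborSet v)ᶜ.ncard := by
    rw [← Set.ncard_coe_finset]
    exact Set.ncard_le_ncard (fun w hw => h w hw) (Set.toFinite _)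
  rw [Nat.card_eq_fintype_card] at h1
  omega

/-- All degrees of `G` lie strictly between `0` and `d`, the matching number is at most `k` and
there are at least `e` edges. -/
structure Witness (d k e : ℕ) {V : Type} (G : SimpleGraph V) : Prop where
  degree_lt : ∀ v, (G.neighborSet v).ncard < d
  exists_adj : ∀ v, ∃ w, G.Adj v w
  matchingNum_le : matchingNum G ≤ k
  le_numEdges : e ≤ numEdges G

theorem Witness.copies {d k e : ℕ} {G : SimpleGraph V} (h : Witness d k e G) (n : ℕ) :
    Witness d (n * k) (n * e) (copies n G) where
  degree_lt x := by
    rw [ncard_neighborSet_copies]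
    exact h.degree_lt _
  exists_adj := fun ⟨i, v⟩ => by
    obtain ⟨w, hw⟩ := h.exists_adj v
    exact ⟨(i, w), rfl, hw⟩
  matchingNum_le := (matchingNum_copies_le n G).trans (Nat.mul_le_mul_left _ h.matchingNum_le)
  le_numEdges := by
    rw [numEdges_copies]
    exact Nat.mul_le_mul_left _ h.le_numEdges

theorem Witness.sum {d k l e f : ℕ} {G : SimpleGraph V} {H : SimpleGraph W}
    (hG : Witness d k e G) (hH : Witness d l f H) : Witness d (k + l) (e + f) (G ⊕g H) where
  degree_lt x := by
    rcases x with v | w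
    · rw [ncard_neighborSet_sum_inl]
      exact hG.degree_lt v
    · rw [ncard_neighborSet_sum_inr]
      exact hH.degree_lt w
  exists_adj x := by
    rcases x with v | v
    · obtain ⟨w, hw⟩ := hG.exists_adj v
      exact ⟨.inl w, hw⟩
    · obtain ⟨w, hw⟩ := hH.exists_adj v
      exact ⟨.inr w, hw⟩
  matchingNum_le :=
    (matchingNum_sum_le G H).trans (add_le_add hG.matchingNum_le hH.matchingNum_le)
  le_numEdges := by
    rw [numEdges_sum]
    exact add_le_add hG.le_numEdges hH.le_numEdges

/-- Edge-maximality is automatic: a graph with more edges would exceed the global bound. -/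
theorem Witness.inFamily {d m k e : ℕ} {G : SimpleGraph V} (h : Witness d k e G)
    (hd : 2 ≤ d) (hk : k < m) (he : extremalSize d m ≤ e) :
    InFamily d m G ∧ numEdges G = extremalSize d m := by
  have h1 : maxDeg G < d := (maxDeg_lt_iff (by omega)).2 h.degree_lt
  have h2 : matchingNum G < m := h.matchingNum_le.trans_lt hk
  have h3 : numEdges G = extremalSize d m :=
    le_antisymm (numEdges_le_extremalSize hd h1 h2) (he.trans h.le_numEdges)
  refine ⟨⟨h1, h2, fun U _ H _ hlt => ?_⟩, h3⟩
  by_contra! hcon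
  have := numEdges_le_extremalSize hd hcon.1 hcon.2
  omega

theorem witness_complete {d n : ℕ} (hn : 2 ≤ n) (hd : n ≤ d) :
    Witness d (n / 2) (n * (n - 1) / 2) (complete n) where
  degree_lt v := by
    have := ncard_neighborSet_lt_card (complete n) v
    rw [Fintype.card_fin] at this
    omega
  exists_adj v := by
    have : Nontrivial (Fin n) := Fin.nontrivial_iff_two_le.2 hn
    obtain ⟨w, hw⟩ := exists_ne v
    exact ⟨w, hw.symm⟩
  matchingNum_le := by
    have := two_mul_matchingNum_le (complete n)
    rw [Fintype.card_fin] at this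
    omega
  le_numEdges := by
    have := card_mul_le_of_nonadj_mem (G := complete n) (S := ∅)
      fun v w h h' => absurd h h'
    rw [Fintype.card_fin, Finset.card_empty] at this
    omega

/-- The `r` left vertices, all of degree d-1, cover every edge. The case `r = 1` is the star. -/
theorem witness_completeBipartiteGraph {d r : ℕ} (hr : 1 ≤ r) (hrd : r < d) (hd : 2 ≤ d) :
    Witness d r (r * (d - 1)) (completeBipartiteGraph (Fin r) (Fin (d - 1))) := by
  have hl : ∀ i, (completeBipartiteGraph (Fin r) (Fin (d - 1))).neighborSet (.inl i) =
      Sum.inr '' Set.univ := by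
    intro i
    ext (v | v) <;> simp
  have hr' : ∀ i, (completeBipartiteGraph (Fin r) (Fin (d - 1))).neighborSet (.inr i) =
      Sum.inl '' Set.univ := by
    intro i
    ext (v | v) <;> simp
  have hl1 : ∀ i, ((completeBipartiteGraph (Fin r) (Fin (d - 1))).neighborSet (.inl i)).ncard =
      d - 1 := fun i => by
    rw [hl, Set.ncard_image_of_injective _ Sum.inr_injective]
    simp
  have hr1 : ∀ i, ((completeBipartiteGraph (Fin r) (Fin (d - 1))).neighborSet (.inr i)).ncard =
      r := fun i => by
    rw [hr', Set.ncard_image_of_injective _ Sum.inl_injective]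
    simp
  refine ⟨?_, ?_, ?_, ?_⟩
  · rintro (v | v)
    · rw [hl1]
      omega
    · rw [hr1]
      exact hrd
  · rintro (v | v)
    · exact ⟨.inr ⟨0, by omega⟩, by simp⟩
    · exact ⟨.inl ⟨0, by omega⟩, by simp⟩
  · refine (matchingNum_le_of_cover (A := univ.map ⟨Sum.inl, Sum.inl_injective⟩) ?_).trans
      (by simp)
    rintro (v | v) (w | w) h <;> simp at h ⊢
  · have h := sum_ncard_neighborSet (completeBipartiteGraph (Fin r) (Fin (d - 1)))
    simp only [Fintype.sum_sum_type, hl1, hr1, Finset.sum_const, Finset.card_univ,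
      Fintype.card_fin, smul_eq_mul] at h
    rw [mul_comm (d - 1) r] at h
    omega

theorem witness_evenC {d j : ℕ} (hj : 2 ≤ j) (hd : d = 2 * j) :
    Witness d j ((2 * j + 1) * (d - 1) / 2) (evenC j) := by
  classical
  subst hd
  have hcard : Fintype.card (Option (Fin (2 * j))) = 2 * j + 1 := by simp
  refine ⟨?_, ?_, ?_, ?_⟩
  · suffices h : ∀ v, ∃ w, w ≠ v ∧ ¬ (evenC j).Adj v w by
      intro v
      obtain ⟨w, hw, hadj⟩ := h v
      have := ncard_neighborSet_add_card_le (G := evenC j) (v := v) (T := {v, w}) (by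
        intro u hu
        rcases mem_insert.1 hu with rfl | hu
        · exact (evenC j).loopless.irrefl _
        · rw [mem_singleton.1 hu]
          exact hadj)
      rw [card_pair hw.symm, hcard] at this
      omega
    rintro (_ | a)
    · exact ⟨some ⟨0, by omega⟩, by simp, by simp [evenC]⟩
    · have ha := a.isLt
      by_cases hp : a.val % 2 = 0
      · refine ⟨some ⟨a.val + 1, by omega⟩, ?_, ?_⟩
        · simp [Fin.ext_iff]
        · simp only [evenC]
          omega
      · refine ⟨some ⟨a.val - 1, by omega⟩, ?_, ?_⟩
        · simp only [ne_eq, Option.some_inj, Fin.ext_iff]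
          omega
        · simp only [evenC]
          omega
  · rintro (_ | a)
    · exact ⟨some ⟨1, by omega⟩, by simp [evenC]⟩
    · by_cases ha : a.val / 2 = 0
      · exact ⟨some ⟨2, by omega⟩, by simp [evenC, ha]⟩
      · exact ⟨some ⟨0, by omega⟩, by simpa [evenC] using ha⟩
  · have := two_mul_matchingNum_le (evenC j)
    rw [hcard] at this
    omega
  · let S : Finset (Sym2 (Option (Fin (2 * j)))) :=
      insert s(none, some ⟨0, by omega⟩) (univ.image fun i : Fin j =>
        s(some ⟨2 * i.val, by omega⟩, some ⟨2 * i.val + 1, by omega⟩))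
    have hS : S.card ≤ j + 1 :=
      (card_insert_le _ _).trans (Nat.add_le_add_right (card_image_le.trans (by simp)) _)
    have h := card_mul_le_of_nonadj_mem (G := evenC j) (S := S) (by
      rintro (_ | a) (_ | b) hne hadj
      · exact absurd rfl hne
      · simp only [evenC, ne_eq, not_not] at hadj
        have : b = ⟨0, by omega⟩ := Fin.ext hadj
        simp [S, this]
      · simp only [evenC, ne_eq, not_not] at hadj
        have : a = ⟨0, by omega⟩ := Fin.ext hadj
        simp [S, this, Sym2.eq_swap]
      · simp only [evenC, ne_eq, not_not] at hadj
        have hne' : a.val ≠ b.val := fun h => hne (congrArg some (Fin.ext h))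
        have ha := a.isLt
        refine mem_insert_of_mem (mem_image.2 ⟨⟨a.val / 2, by omega⟩, mem_univ _, ?_⟩)
        simp only [Sym2.eq_iff, Option.some_inj, Fin.ext_iff]
        omega)
    rw [hcard] at h
    obtain ⟨t, rfl⟩ : ∃ t, j = t + 1 := ⟨j - 1, by omega⟩
    have e1 : (2 * (t + 1) + 1) * (2 * (t + 1) - 1) = 4 * (t * t) + 8 * t + 3 := by
      rw [show 2 * (t + 1) - 1 = 2 * t + 1 by omega]
      ring
    have e2 : (2 * (t + 1) + 1) * (2 * (t + 1) + 1 - 1) = 4 * (t * t) + 10 * t + 6 := by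
      rw [Nat.add_sub_cancel]
      ring
    rw [e1]
    rw [e2] at h
    omega

theorem witness_graphC {d : ℕ} (hd : 3 ≤ d) :
    Witness d (halfCeil d) ((2 * halfCeil d + 1) * (d - 1) / 2) (graphC d) := by
  have hc := halfCeil_eq d
  rw [graphC]
  split_ifs with hodd
  · have hd1 : d = 2 * halfCeil d + 1 := by
      obtain ⟨k, rfl⟩ := hodd
      omega
    have hcard : Fintype.card (Option (Fin (2 * halfCeil d))) = 2 * halfCeil d + 1 := by simp
    refine ⟨fun v => ?_, fun v => ?_, ?_, ?_⟩
    · exact (ncard_neighborSet_lt_card _ v).trans_eq (hcard.trans hd1.symm)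
    · have : Nontrivial (Option (Fin (2 * halfCeil d))) := by
        rw [← Fintype.one_lt_card_iff_nontrivial, hcard]
        omega
      obtain ⟨w, hw⟩ := exists_ne v
      exact ⟨w, hw.symm⟩
    · have := two_mul_matchingNum_le (⊤ : SimpleGraph (Option (Fin (2 * halfCeil d))))
      rw [hcard] at this
      omega
    · have := card_mul_le_of_nonadj_mem (G := (⊤ : SimpleGraph (Option (Fin (2 * halfCeil d)))))
        (S := ∅) fun v w h h' => absurd h h'
      rw [hcard, Finset.card_empty] at this
      rw [show d - 1 = 2 * halfCeil d + 1 - 1 by omega]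
      omega
  · have heven : d = 2 * halfCeil d := by
      rw [Nat.not_odd_iff_even] at hodd
      obtain ⟨k, rfl⟩ := hodd
      omega
    exact witness_evenC (by omega) heven

/-- A graph on `2 * c + 3` vertices. It is regular of degree `2 * c` if `P` is false, and otherwise
all degrees are `2 * c - 1`, except that one of them is `2 * c - 2`. -/
def nearRegular (c : ℕ) (P : Prop) : SimpleGraph (Fin (2 * c + 3)) where
  Adj a b := a ≠ b ∧ a.val + 1 ≠ b.val ∧ b.val + 1 ≠ a.val ∧
    ¬ (a.val = 0 ∧ b.val = 2 * c + 2) ∧ ¬ (b.val = 0 ∧ a.val = 2 * c + 2) ∧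
    (P → a.val + c + 1 ≠ b.val ∧ b.val + c + 1 ≠ a.val)
  symm := ⟨fun _ _ h => ⟨h.1.symm, h.2.2.1, h.2.1, h.2.2.2.2.1, h.2.2.2.1,
    fun hd => (h.2.2.2.2.2 hd).symm⟩⟩
  loopless := ⟨fun _ h => h.1 rfl⟩

theorem nearRegular_degree_lt {c d : ℕ} {P : Prop} (hc : 2 ≤ c)
    (hd : P ∧ d = 2 * c ∨ ¬ P ∧ d = 2 * c + 1) (v : Fin (2 * c + 3)) :
    ((nearRegular c P).neighborSet v).ncard < d := by
  have hv := v.isLt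
  obtain ⟨a, ha⟩ : ∃ a : Fin (2 * c + 3), a.val = v.val + 1 ∨ v.val = 2 * c + 2 ∧ a.val = 0 := by
    by_cases h : v.val = 2 * c + 2
    · exact ⟨⟨0, by omega⟩, Or.inr ⟨h, rfl⟩⟩
    · exact ⟨⟨v.val + 1, by omega⟩, Or.inl rfl⟩
  obtain ⟨b, hb⟩ : ∃ b : Fin (2 * c + 3), b.val + 1 = v.val ∨ v.val = 0 ∧ b.val = 2 * c + 2 := by
    by_cases h : v.val = 0
    · exact ⟨⟨2 * c + 2, by omega⟩, Or.inr ⟨h, rfl⟩⟩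
    · exact ⟨⟨v.val - 1, by omega⟩, Or.inl (by simp only; omega)⟩
  have hva : v ∉ ({a, b} : Finset (Fin (2 * c + 3))) := by
    simp only [mem_insert, mem_singleton, Fin.ext_iff]
    omega
  have hab : a ≠ b := by
    simp only [ne_eq, Fin.ext_iff]
    omega
  have h3 : #{v, a, b} = 3 := by rw [card_insert_of_notMem hva, card_pair hab]
  have hn3 : ∀ w ∈ ({v, a, b} : Finset (Fin (2 * c + 3))), ¬ (nearRegular c P).Adj v w := by
    intro w hw hadj
    simp only [mem_insert, mem_singleton, Fin.ext_iff] at hw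
    simp only [nearRegular, ne_eq, Fin.ext_iff] at hadj
    omega
  by_cases hpar : P
  · have hd2 : d = 2 * c := by tauto
    -- For even d a third non-neighbour besides the two on the cycle: an end of a removed chord at
    -- distance c + 1.
    obtain ⟨f, hf⟩ : ∃ f : Fin (2 * c + 3), f.val = v.val + c + 1 ∨ f.val + c + 1 = v.val := by
      by_cases h : v.val ≤ c + 1
      · exact ⟨⟨v.val + c + 1, by omega⟩, Or.inl rfl⟩
      · exact ⟨⟨v.val - (c + 1), by omega⟩, Or.inr (by simp only; omega)⟩
    have hfn : f ∉ ({v, a, b} : Finset (Fin (2 * c + 3))) := by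
      simp only [mem_insert, mem_singleton, Fin.ext_iff]
      omega
    have := ncard_neighborSet_add_card_le (G := nearRegular c P) (v := v) (T := {f, v, a, b}) (by
      intro w hw
      rcases mem_insert.1 hw with rfl | hw
      · intro hadj
        have := hadj.2.2.2.2.2 hpar
        omega
      · exact hn3 w hw)
    rw [card_insert_of_notMem hfn, h3, Fintype.card_fin] at this
    omega
  · have hd2 : d = 2 * c + 1 := by tauto
    have := ncard_neighborSet_add_card_le hn3
    rw [h3, Fintype.card_fin] at this
    omega

theorem le_numEdges_nearRegular {c d : ℕ} {P : Prop} (hc : 2 ≤ c)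
    (hd : P ∧ d = 2 * c ∨ ¬ P ∧ d = 2 * c + 1) :
    (2 * c + 3) * (d - 1) / 2 ≤ numEdges (nearRegular c P) := by
  classical
  -- The removed cycle has 2c+3 edges. Since the order is odd, the c+2 removed chords meet the
  -- vertex c+1 twice and every other vertex once.
  let S₁ : Finset (Sym2 (Fin (2 * c + 3))) := insert s(⟨0, by omega⟩, ⟨2 * c + 2, by omega⟩)
    (univ.image fun i : Fin (2 * c + 2) => s(⟨i.val, by omega⟩, ⟨i.val + 1, by omega⟩))
  let S₂ : Finset (Sym2 (Fin (2 * c + 3))) :=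
    univ.image fun i : Fin (c + 2) => s(⟨i.val, by omega⟩, ⟨i.val + c + 1, by omega⟩)
  have hS₁ : S₁.card ≤ 2 * c + 3 :=
    (card_insert_le _ _).trans (Nat.add_le_add_right (card_image_le.trans (by simp)) _)
  have hS₂ : S₂.card ≤ c + 2 := card_image_le.trans (by simp)
  have key : ∀ v w : Fin (2 * c + 3), v ≠ w → ¬ (nearRegular c P).Adj v w →
      s(v, w) ∈ S₁ ∨ P ∧ s(v, w) ∈ S₂ := by
    intro v w hne hadj
    have hne' : v.val ≠ w.val := fun h => hne (Fin.ext h)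
    have hv := v.isLt
    have hw := w.isLt
    have hcases : v.val + 1 = w.val ∨ w.val + 1 = v.val ∨ (v.val = 0 ∧ w.val = 2 * c + 2) ∨
        (w.val = 0 ∧ v.val = 2 * c + 2) ∨
        P ∧ (v.val + c + 1 = w.val ∨ w.val + c + 1 = v.val) := by
      by_contra hcon
      push Not at hcon
      exact hadj ⟨hne, hcon.1, hcon.2.1, fun h => hcon.2.2.1 h.1 h.2,
        fun h => hcon.2.2.2.1 h.1 h.2, hcon.2.2.2.2⟩
    rcases hcases with h | h | h | h | ⟨he, h⟩
    · refine Or.inl (mem_insert_of_mem (mem_image.2 ⟨⟨v.val, by omega⟩, mem_univ _, ?_⟩))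
      simp only [Sym2.eq_iff, Fin.ext_iff, true_and]
      omega
    · refine Or.inl (mem_insert_of_mem (mem_image.2 ⟨⟨w.val, by omega⟩, mem_univ _, ?_⟩))
      simp only [Sym2.eq_iff, Fin.ext_iff, true_and]
      omega
    · refine Or.inl (mem_insert.2 (Or.inl ?_))
      simp only [Sym2.eq_iff, Fin.ext_iff]
      omega
    · refine Or.inl (mem_insert.2 (Or.inl ?_))
      simp only [Sym2.eq_iff, Fin.ext_iff]
      omega
    · right
      refine ⟨he, ?_⟩
      rcases h with h | h
      · refine mem_image.2 ⟨⟨v.val, by omega⟩, mem_univ _, ?_⟩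
        simp only [Sym2.eq_iff, Fin.ext_iff, true_and]
        omega
      · refine mem_image.2 ⟨⟨w.val, by omega⟩, mem_univ _, ?_⟩
        simp only [Sym2.eq_iff, Fin.ext_iff, true_and]
        omega
  by_cases hpar : P
  · have hd2 : d = 2 * c := by tauto
    have h := card_mul_le_of_nonadj_mem (G := nearRegular c P) (S := S₁ ∪ S₂) fun v w h1 h2 =>
      mem_union.2 ((key v w h1 h2).imp_right And.right)
    have hu := card_union_le S₁ S₂
    rw [Fintype.card_fin] at h
    obtain ⟨t, ht⟩ : ∃ t, c = t + 1 := ⟨c - 1, by omega⟩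
    have e1 : (2 * c + 3) * (d - 1) = 4 * (t * t) + 12 * t + 5 := by
      rw [show d - 1 = 2 * t + 1 by omega, ht]
      ring
    have e2 : (2 * c + 3) * (2 * c + 3 - 1) = 4 * (t * t) + 18 * t + 20 := by
      rw [ht, show 2 * (t + 1) + 3 - 1 = 2 * t + 4 by omega]
      ring
    rw [e1]
    rw [e2] at h
    omega
  · have hd2 : d = 2 * c + 1 := by tauto
    have h := card_mul_le_of_nonadj_mem (G := nearRegular c P) (S := S₁) fun v w h1 h2 =>
      (key v w h1 h2).resolve_right fun h => hpar h.1
    rw [Fintype.card_fin] at h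
    have e1 : (2 * c + 3) * (d - 1) = 4 * (c * c) + 6 * c := by
      rw [show d - 1 = 2 * c by omega]
      ring
    have e2 : (2 * c + 3) * (2 * c + 3 - 1) = 4 * (c * c) + 10 * c + 6 := by
      rw [show 2 * c + 3 - 1 = 2 * c + 2 by omega]
      ring
    rw [e1]
    rw [e2] at h
    omega

/-- With 2(c+1)+1 vertices it allows the same matching number and has at least as many edges as one
C and one star together, which it can therefore replace. -/
theorem witness_nearRegular {c d : ℕ} {P : Prop} (hc : 2 ≤ c)
    (hd : P ∧ d = 2 * c ∨ ¬ P ∧ d = 2 * c + 1) :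
    Witness d (c + 1) ((2 * c + 3) * (d - 1) / 2) (nearRegular c P) where
  degree_lt := nearRegular_degree_lt hc hd
  exists_adj v := by
    have hv := v.isLt
    -- Distance two is neither a cycle edge nor, as c ≥ 2, a removed chord.
    by_cases h : v.val + 2 < 2 * c + 3
    · refine ⟨⟨v.val + 2, h⟩, ?_⟩
      simp only [nearRegular, ne_eq, Fin.ext_iff]
      omega
    · refine ⟨⟨v.val - 2, by omega⟩, ?_⟩
      simp only [nearRegular, ne_eq, Fin.ext_iff]
      omega
  matchingNum_le := by
    have := two_mul_matchingNum_le (nearRegular c P)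
    rw [Fintype.card_fin] at this
    omega
  le_numEdges := le_numEdges_nearRegular hc hd

end Constructions

/-! ### Extremal graphs, their uniqueness and non-uniqueness -/

section Extremal

variable {V W : Type} [Fintype V] [Fintype W] {G : SimpleGraph V} {H : SimpleGraph W} {d m : ℕ}

theorem odd_mul_div_two (c x : ℕ) : (2 * c + 1) * x / 2 = c * x + x / 2 := by
  rw [add_mul, one_mul, mul_assoc]
  omega

/-- The bound in the shape of the construction: q copies of C and r stars. -/
theorem extremalSize_eq {q r : ℕ} (h : m - 1 = q * halfCeil d + r) (hr : r < halfCeil d) :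
    extremalSize d m = q * ((2 * halfCeil d + 1) * (d - 1) / 2) + r * (d - 1) := by
  have hdiv : (m - 1) / halfCeil d = q := by
    rw [h]
    refine Nat.div_eq_of_lt_le (by omega) ?_
    rw [add_mul, one_mul]
    omega
  rw [extremalSize, hdiv, h, odd_mul_div_two]
  ring

theorem witness_copies_graphC_sum_copies_star (hd : 3 ≤ d) (q r : ℕ) :
    Witness d (q * halfCeil d + r) (q * ((2 * halfCeil d + 1) * (d - 1) / 2) + r * (d - 1))
      (copies q (graphC d) ⊕g copies r (star (d - 1))) := by
  simpa using ((witness_graphC hd).copies q).sum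
    ((witness_completeBipartiteGraph le_rfl (by omega) (by omega)).copies r)

theorem exists_witness (hd : 2 ≤ d) (hm : 2 ≤ m) :
    ∃ (V : Type) (_ : Fintype V) (G : SimpleGraph V) (k : ℕ), k < m ∧
      Witness d k (extremalSize d m) G := by
  rcases hd.eq_or_lt with rfl | hd
  · refine ⟨_, inferInstance, copies (m - 1) (complete 2), _, ?_,
      by simpa [extremalSize] using (witness_complete le_rfl le_rfl).copies (m - 1)⟩
    omega
  · have hc : 0 < halfCeil d := by rw [halfCeil_eq]; omega
    have h := (Nat.div_add_mod' (m - 1) (halfCeil d)).symm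
    refine ⟨_, inferInstance, _, _, ?_, by
      rw [extremalSize_eq h (Nat.mod_lt _ hc)]
      exact witness_copies_graphC_sum_copies_star hd _ _⟩
    omega

theorem maxEdges_eq (hd : 2 ≤ d) (hm : 2 ≤ m) : maxEdges d m = extremalSize d m := by
  obtain ⟨V, _, G, k, hk, hG⟩ := exists_witness hd hm
  obtain ⟨h1, h2⟩ := hG.inFamily hd hk le_rfl
  have hub : ∀ n ∈ {n | ∃ (V : Type) (_ : Fintype V) (G : SimpleGraph V),
      InFamily d m G ∧ numEdges G = n}, n ≤ extremalSize d m := by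
    rintro _ ⟨U, _, K, hK, rfl⟩
    exact numEdges_le_extremalSize hd hK.1 hK.2.1
  exact le_antisymm (csSup_le ⟨_, V, _, G, h1, rfl⟩ hub) (le_csSup ⟨_, hub⟩ ⟨V, _, G, h1, h2⟩)

theorem Witness.isExtremal {k e : ℕ} (h : Witness d k e G) (hd : 2 ≤ d) (hm : 2 ≤ m)
    (hk : k < m) (he : extremalSize d m ≤ e) : IsExtremal d m G := by
  obtain ⟨h1, h2⟩ := h.inFamily hd hk he
  exact ⟨h1, h.exists_adj, h2.trans (maxEdges_eq hd hm).symm⟩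

/-- Transfers uniqueness to another description of the extremal graph without constructing an
isomorphism. -/
theorem IsTheExtremal.of_isExtremal (hG : IsTheExtremal d m G) (hH : IsExtremal d m H) :
    IsTheExtremal d m H := by
  obtain ⟨e⟩ := hG.2 W H hH
  refine ⟨hH, fun U _ K hK => ?_⟩
  obtain ⟨f⟩ := hG.2 U K hK
  exact ⟨f.trans e.symm⟩

theorem hasSeveralExtremal_of_card_ne (hG : IsExtremal d m G) (hH : IsExtremal d m H)
    (hne : Fintype.card V ≠ Fintype.card W) : HasSeveralExtremal d m :=
  ⟨V, _, G, W, _, H, hG, hH, ⟨fun e => hne (Fintype.card_congr e.toEquiv)⟩⟩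

theorem HasSeveralExtremal.not_hasUniqueExtremal (h : HasSeveralExtremal d m) :
    ¬ HasUniqueExtremal d m := by
  rintro ⟨U, _, K, -, hK⟩
  obtain ⟨V, _, G, W, _, H, hG, hH, hne⟩ := h
  obtain ⟨e⟩ := hK V G hG
  obtain ⟨f⟩ := hK W H hH
  exact hne.false (e.trans f.symm)

theorem isTheExtremal_copies_graphC (hd : 3 ≤ d) (hm : 2 ≤ m) (hdvd : halfCeil d ∣ m - 1) :
    IsTheExtremal d m (copies ((m - 1) / halfCeil d) (graphC d)) := by
  classical
  have hc : 0 < halfCeil d := by rw [halfCeil_eq]; omega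
  have hmul := Nat.div_mul_cancel hdvd
  refine ⟨((witness_graphC hd).copies _).isExtremal (by omega) hm (by omega)
    (by rw [extremalSize_eq (r := 0) hmul.symm hc]; simp), ?_⟩
  intro U _ K hK
  rw [IsExtremal, maxEdges_eq (by omega) hm] at hK
  obtain ⟨⟨h1, h2, -⟩, h3, h4⟩ := hK
  obtain ⟨ι, _, comp, hcomp, hι, hpart⟩ := exists_parts_of_numEdges_eq hd h1 h2 hdvd h3 h4
  refine nonempty_iso_copies hcomp hι fun i => nonempty_iso_graphC (by omega) ?_ ?_ (hpart i).2
  · rw [← Nat.card_eq_fintype_card, Nat.card_coe_set_eq, (hpart i).1]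
  · rw [maxDeg_lt_iff (by omega)] at h1
    exact fun v => (ncard_neighborSet_induce_le K _ v).trans_lt (h1 v)

theorem isTheExtremal_copies_complete_two (hm : 2 ≤ m) :
    IsTheExtremal 2 m (copies (m - 1) (complete 2)) := by
  have hsize : extremalSize 2 m = m - 1 := by simp [extremalSize]
  refine ⟨((witness_complete le_rfl le_rfl).copies _).isExtremal le_rfl hm (by omega) (by omega), ?_⟩
  intro U _ K hK
  rw [IsExtremal, maxEdges_eq le_rfl hm, hsize] at hK
  obtain ⟨⟨h1, -, -⟩, h3, h4⟩ := hK
  rw [maxDeg_lt_iff two_pos] at h1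
  have hone : ∀ v, (K.neighborSet v).ncard = 1 := fun v => by
    obtain ⟨w, hw⟩ := h3 v
    have hpos : 0 < (K.neighborSet v).ncard := (Set.ncard_pos (Set.toFinite _)).2 ⟨w, hw⟩
    have := h1 v
    omega
  have hcard := sum_ncard_neighborSet K
  simp only [hone, Finset.sum_const, Finset.card_univ, smul_eq_mul, mul_one, h4] at hcard
  obtain ⟨x⟩ : Nonempty U := Fintype.card_pos_iff.1 (by omega)
  obtain ⟨e, -⟩ := exists_iso_copies_complete_two (H := K) (fun v => by
    obtain ⟨w, hw⟩ := Set.ncard_eq_one.1 (hone v)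
    exact ⟨w, (hw ▸ rfl : w ∈ K.neighborSet v), fun y hy => by
      have : y ∈ K.neighborSet v := hy
      rwa [hw] at this⟩) hcard x ⟨0, by omega⟩
  exact ⟨e⟩

/-- A graph without isolated vertices whose edges all contain `a` is a star. -/
theorem nonempty_iso_star {k : ℕ} {a : V} (ha : ∀ v w, G.Adj v w → v = a ∨ w = a)
    (hiso : ∀ v, ∃ w, G.Adj v w) (hk : numEdges G = k) : Nonempty (G ≃g star k) := by
  classical
  have hadj : ∀ v, v ≠ a → G.Adj a v := fun v hv => by
    obtain ⟨w, hw⟩ := hiso v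
    obtain rfl : w = a := (ha v w hw).resolve_left hv
    exact hw.symm
  have hcard : Fintype.card {v // v ≠ a} = k := by
    rw [← hk, numEdges, ← Nat.card_coe_set_eq, ← Nat.card_eq_fintype_card]
    refine Nat.card_congr (Equiv.ofBijective
      (fun v => ⟨s(a, v.1), hadj v.1 v.2⟩ : {v // v ≠ a} → G.edgeSet) ⟨?_, ?_⟩)
    · intro v w h
      exact Subtype.ext (Sym2.congr_right.1 (congrArg Subtype.val h))
    · rintro ⟨e, he⟩
      induction e with | _ v w
      rcases ha v w he with rfl | rfl
      · exact ⟨⟨w, he.ne'⟩, rfl⟩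
      · exact ⟨⟨v, he.ne⟩, Subtype.ext Sym2.eq_swap⟩
  let σ : {v // v ≠ a} ≃ Fin k := Fintype.equivFinOfCardEq hcard
  let f : V → Fin 1 ⊕ Fin k := fun v => if h : v = a then .inl 0 else .inr (σ ⟨v, h⟩)
  have hfa : f a = .inl 0 := dif_pos rfl
  have hf : ∀ v (h : v ≠ a), f v = .inr (σ ⟨v, h⟩) := fun v h => dif_neg h
  have hbij : f.Bijective := by
    constructor
    · intro v w h
      by_cases hv : v = a <;> by_cases hw : w = a
      · rw [hv, hw]
      · rw [hv, hfa, hf w hw] at h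
        cases h
      · rw [hw, hfa, hf v hv] at h
        cases h
      · rw [hf v hv, hf w hw] at h
        exact congrArg Subtype.val (σ.injective (Sum.inr_injective h))
    · rintro (i | i)
      · exact ⟨a, hfa.trans (congrArg _ (Subsingleton.elim _ _))⟩
      · refine ⟨(σ.symm i).1, ?_⟩
        rw [hf _ (σ.symm i).2]
        exact congrArg Sum.inr (σ.apply_symm_apply i)
  refine ⟨⟨Equiv.ofBijective f hbij, fun {v w} => ?_⟩⟩
  change (star k).Adj (f v) (f w) ↔ G.Adj v w
  by_cases hv : v = a <;> by_cases hw : w = a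
  · subst hv hw
    simp
  · subst hv
    rw [hfa, hf w hw]
    simp [hadj w hw]
  · subst hw
    rw [hfa, hf v hv]
    simp [(hadj v hv).symm]
  · rw [hf v hv, hf w hw]
    have : ¬ G.Adj v w := fun h => (ha v w h).elim hv hw
    simp [this]

theorem extremalSize_two (hd : 4 ≤ d) : extremalSize d 2 = d - 1 := by
  have : halfCeil d = d / 2 := halfCeil_eq d
  rw [extremalSize, Nat.div_eq_of_lt (a := 2 - 1) (by omega)]
  simp

/-- Here |A| + Σ⌊n_i/2⌋ ≤ 1. If `A` is empty, at most one class has more than one vertex and it has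
at most three, giving at most 3 < d-1 edges. So `A` is one vertex, all classes have at most one
vertex, and every edge passes through `A`. -/
theorem isTheExtremal_star (hd : 5 ≤ d) : IsTheExtremal d 2 (star (d - 1)) := by
  classical
  refine ⟨(witness_completeBipartiteGraph (d := d) le_rfl (by omega) (by omega)).isExtremal
    (by omega) le_rfl one_lt_two (by rw [extremalSize_two (by omega), one_mul]), ?_⟩
  intro U _ K hK
  rw [IsExtremal, maxEdges_eq (by omega) le_rfl, extremalSize_two (by omega)] at hK
  obtain ⟨⟨-, h2, -⟩, h3, h4⟩ := hK
  obtain ⟨A, ι, _, comp, hs, hν⟩ := exists_splits_le_matchingNum K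
  have hE := numEdges_le_of_splits hs
  by_cases hA : A.card = 0
  · exfalso
    have hpart : ∀ i ∈ univ, numEdges (K.induce (part A comp i)) ≤
        3 * ((part A comp i).ncard / 2) := by
      intro i _
      have h5 := Finset.single_le_sum (f := fun i => (part A comp i).ncard / 2)
        (fun _ _ => Nat.zero_le _) (mem_univ i)
      have h6 := two_mul_numEdges_le (ncard_neighborSet_lt_card (K.induce (part A comp i)))
      rw [← Nat.card_eq_fintype_card, Nat.card_coe_set_eq] at h6
      have h7 : (part A comp i).ncard ≤ 3 := by omega
      interval_cases (part A comp i).ncard <;> omega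
    have h5 := Finset.sum_le_sum hpart
    rw [← Finset.mul_sum] at h5
    rw [Finset.card_eq_zero.1 hA, Finset.sum_empty] at hE
    rw [Finset.card_eq_zero.1 hA] at h5 hν
    omega
  · obtain ⟨a, rfl⟩ := Finset.card_eq_one.1 (show A.card = 1 by omega)
    rw [card_singleton] at hν
    refine nonempty_iso_star (a := a) (fun v w hvw => ?_) h3 h4
    rcases edgeSet_subset_of_splits hs (e := s(v, w)) hvw with ⟨b, hb, hbe⟩ | ⟨i, hi⟩
    · obtain rfl := mem_singleton.1 hb
      exact (Sym2.mem_iff.1 hbe).imp Eq.symm Eq.symm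
    · have h5 := Finset.single_le_sum (f := fun i => (part {a} comp i).ncard / 2)
        (fun _ _ => Nat.zero_le _) (mem_univ i)
      have h6 : (part {a} comp i).ncard ≤ 1 := by omega
      rw [Set.ncard_le_one] at h6
      exact absurd (h6 v (hi v (by simp)) w (hi w (by simp))) hvw.ne

/-- A graph on `2 * ⌈(d - 1) / 2⌉ + 1` vertices with the largest possible number of edges is
factor-critical. -/
theorem isLargestCritical_of_numEdges (hd : 3 ≤ d)
    (hcard : Fintype.card V = 2 * halfCeil d + 1) (hdeg : ∀ v, (G.neighborSet v).ncard < d)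
    (hE : numEdges G = (2 * halfCeil d + 1) * (d - 1) / 2) : IsLargestCritical d G := by
  classical
  have hc : 0 < halfCeil d := by rw [halfCeil_eq]; omega
  have hsize : extremalSize d (halfCeil d) = (d - 1) * (halfCeil d - 1) := by
    rw [extremalSize, Nat.div_eq_of_lt (a := halfCeil d - 1) (by omega), mul_zero, add_zero]
  rw [odd_mul_div_two] at hE
  have hmul : halfCeil d * (d - 1) = (d - 1) * (halfCeil d - 1) + (d - 1) := by
    obtain ⟨t, ht⟩ : ∃ t, halfCeil d = t + 1 := ⟨halfCeil d - 1, by omega⟩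
    rw [ht, Nat.add_sub_cancel]
    ring
  have hmax : maxDeg G < d := (maxDeg_lt_iff (by omega)).2 hdeg
  refine ⟨fun v => ?_, ?_, hmax, by rw [hE, odd_mul_div_two]⟩
  · have hdeg' : maxDeg (G.induce {v}ᶜ) < d := (maxDeg_lt_iff (by omega)).2 fun w =>
      (ncard_neighborSet_induce_le G _ w).trans_lt (hdeg w)
    -- Deleting `v` loses at most d-1 edges and leaves at least (c-1)(d-1) + ⌊(d-1)/2⌋. This exceeds
    -- (c-1)(d-1), the maximum for matching number below c.
    have hν : halfCeil d ≤ matchingNum (G.induce {v}ᶜ) := by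
      by_contra! hlt
      have h1 := numEdges_le_extremalSize (by omega) hdeg' hlt
      have h2 := numEdges_le_of_splits (G := G) (A := {v}) (comp := fun _ => ())
        fun _ _ _ _ _ => rfl
      have h3 : part {v} (fun _ => ()) () = {v}ᶜ := by
        ext w
        simp [part]
      rw [Finset.sum_singleton, Fintype.sum_unique] at h2
      change _ ≤ _ + numEdges (G.induce (part {v} (fun _ => ()) ())) at h2
      rw [h3] at h2
      have := hdeg v
      omega
    obtain ⟨M, hM, hMcard⟩ := exists_matching (G.induce {v}ᶜ)
    refine ⟨M, hM, ?_⟩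
    have h4 := two_mul_ncard_edgeSet hM
    have h5 := Set.ncard_add_ncard_compl M.verts
    have h6 := Set.ncard_add_ncard_compl ({v} : Set V)
    rw [Nat.card_coe_set_eq] at h5
    rw [Nat.card_eq_fintype_card, hcard, Set.ncard_singleton] at h6
    have h7 : M.vertsᶜ.ncard = 0 := by omega
    rw [Set.ncard_eq_zero, Set.compl_empty_iff] at h7
    exact Subgraph.isSpanning_iff.2 h7
  · refine le_antisymm ?_ ?_
    · have := two_mul_matchingNum_le G
      omega
    · by_contra! hlt
      have := numEdges_le_extremalSize (by omega) hmax hlt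
      omega

/-- The perfect matching after deleting a vertex has some k ≤ c edges, so the order is 2k+1; as it
is at least 2c, k = c. Positivity of `c` supplies a vertex to delete. -/
theorem card_of_factorCritical {c : ℕ} (hc : 0 < c) (hG : FactorCritical G)
    (hν : matchingNum G = c) : Fintype.card V = 2 * c + 1 := by
  have h1 := two_mul_matchingNum_le G
  obtain ⟨v⟩ : Nonempty V := Fintype.card_pos_iff.1 (by omega)
  obtain ⟨M, hM, hspan⟩ := hG v
  have h2 := two_mul_ncard_edgeSet hM
  have hM' := Subgraph.IsMatching.map (Embedding.induce {v}ᶜ).toHom Subtype.val_injective hM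
  have h3 := two_mul_ncard_edgeSet hM'
  have h4 := le_matchingNum hM'
  have h5 : ((Embedding.induce (G := G) {v}ᶜ).toHom '' M.verts).ncard = M.verts.ncard :=
    Set.ncard_image_of_injective _ Subtype.val_injective
  rw [Subgraph.map_verts, h5] at h3
  rw [Subgraph.isSpanning_iff.1 hspan, Set.ncard_univ, Nat.card_coe_set_eq] at h2 h3
  have h6 := Set.ncard_add_ncard_compl ({v} : Set V)
  rw [Nat.card_eq_fintype_card, Set.ncard_singleton] at h6
  omega

theorem nonempty_iso_graphC_of_isLargestCritical (hd : 3 ≤ d) (hG : IsLargestCritical d G) :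
    Nonempty (G ≃g graphC d) := by
  obtain ⟨h1, h2, h3, h4⟩ := hG
  have hc : 0 < halfCeil d := by rw [halfCeil_eq]; omega
  exact nonempty_iso_graphC (by omega) (card_of_factorCritical hc h1 h2)
    ((maxDeg_lt_iff (by omega)).1 h3) h4

theorem isLargestCritical_graphC (hd : 3 ≤ d) : IsLargestCritical d (graphC d) := by
  have h := witness_graphC hd
  have hcard : Fintype.card (Option (Fin (2 * halfCeil d))) = 2 * halfCeil d + 1 := by simp
  refine isLargestCritical_of_numEdges hd hcard h.degree_lt (le_antisymm ?_ h.le_numEdges)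
  have := two_mul_numEdges_le h.degree_lt
  rw [hcard] at this
  omega

/-- The exchanges preserve the matching and edge bounds but change the order: r stars have rd
vertices against r+d-1 for K_{r,d-1}, while C and a star have 2c+1+d against 2c+3. -/
theorem hasSeveralExtremal_of_not_dvd (hd : 3 ≤ d) (hm : 3 ≤ m) (hdvd : ¬ halfCeil d ∣ m - 1) :
    HasSeveralExtremal d m := by
  have hc := halfCeil_eq d
  have hc1 : halfCeil d ≠ 1 := fun h => hdvd (by
    rw [h]
    exact one_dvd _)
  have hpos : 0 < halfCeil d := by omega
  have hdiv := (Nat.div_add_mod' (m - 1) (halfCeil d)).symm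
  have hr := Nat.mod_lt (m - 1) hpos
  have hr0 : (m - 1) % halfCeil d ≠ 0 := fun h => hdvd (Nat.dvd_of_mod_eq_zero h)
  generalize (m - 1) / halfCeil d = q at hdiv
  generalize (m - 1) % halfCeil d = r at hdiv hr hr0
  have hsize := extremalSize_eq hdiv hr
  have hG := (witness_copies_graphC_sum_copies_star hd q r).isExtremal (m := m) (by omega)
    (by omega) (by omega) hsize.le
  by_cases hr2 : 2 ≤ r
  · refine hasSeveralExtremal_of_card_ne hG ((((witness_graphC hd).copies q).sum
      (witness_completeBipartiteGraph (r := r) (by omega) (by omega) (by omega))).isExtremal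
      (by omega) (by omega) (by omega) hsize.le) ?_
    have := Nat.mul_le_mul_right (d - 1) hr2
    simp only [Fintype.card_sum, Fintype.card_prod, Fintype.card_fin, Fintype.card_option,
      mul_add r, mul_one]
    omega
  · obtain rfl : r = 1 := by omega
    -- A copy of C is available for the exchange, since q = 0 and r = 1 would give m = 2.
    obtain ⟨p, rfl⟩ : ∃ p, q = p + 1 := by
      refine ⟨q - 1, ?_⟩
      have : q ≠ 0 := by
        rintro rfl
        omega
      omega
    have hN := witness_nearRegular (c := halfCeil d) (d := d) (P := Even d) (by omega) (by
      rcases Nat.even_or_odd d with h | h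
      · refine Or.inl ⟨h, ?_⟩
        obtain ⟨k, rfl⟩ := h
        omega
      · refine Or.inr ⟨Nat.not_even_iff_odd.2 h, ?_⟩
        obtain ⟨k, rfl⟩ := h
        omega)
    refine hasSeveralExtremal_of_card_ne hG ((((witness_graphC hd).copies p).sum hN).isExtremal
      (by omega) (by omega) ?_ ?_) ?_
    · rw [add_mul] at hdiv
      omega
    · rw [hsize, add_mul p, one_mul, one_mul, add_assoc]
      refine Nat.add_le_add_left (le_of_eq ?_) _
      rw [show 2 * halfCeil d + 3 = 2 * (halfCeil d + 1) + 1 by ring, odd_mul_div_two,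
        odd_mul_div_two, add_mul]
      omega
    · simp only [Fintype.card_sum, Fintype.card_prod, Fintype.card_fin, Fintype.card_option,
        add_mul p]
      omega

/-- K_{1,3} and K_3 both have three edges and matching number 1. -/
theorem hasSeveralExtremal_four_two : HasSeveralExtremal 4 2 := by
  have hsize : extremalSize 4 2 = 3 := extremalSize_two le_rfl
  refine hasSeveralExtremal_of_card_ne
    ((witness_completeBipartiteGraph (d := 4) (r := 1) le_rfl (by omega) (by omega)).isExtremal
      (by omega) le_rfl one_lt_two (by omega))
    ((witness_complete (d := 4) (n := 3) (by omega) (by omega)).isExtremal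
      (by omega) le_rfl (by omega) (by omega)) (by simp)

theorem extremalSize_self_of_odd (hd : 2 ≤ d) (hodd : Odd d) :
    extremalSize d d = d * (d - 1) := by
  obtain ⟨j, rfl⟩ := hodd
  have hc : halfCeil (2 * j + 1) = j := by rw [halfCeil_eq]; omega
  rw [extremalSize, hc, Nat.add_sub_cancel, Nat.mul_div_cancel _ (by omega),
    Nat.mul_div_cancel_left _ two_pos]
  ring

theorem extremalSize_self_of_even (hd : 2 ≤ d) (heven : Even d) :
    extremalSize d d = (2 * d - 1) * (d - 1) / 2 := by
  obtain ⟨j, rfl⟩ := heven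
  obtain ⟨t, rfl⟩ : ∃ t, j = t + 1 := ⟨j - 1, by omega⟩
  have hc : halfCeil (t + 1 + (t + 1)) = t + 1 := by rw [halfCeil_eq]; omega
  have h1 : t + 1 + (t + 1) - 1 = 2 * t + 1 := by omega
  have h2 : (2 * t + 1) / (t + 1) = 1 :=
    Nat.div_eq_of_lt_le (by omega) (by omega)
  have h3 : 2 * (t + 1 + (t + 1)) - 1 = 2 * (2 * t + 1) + 1 := by omega
  rw [extremalSize, hc, h1, h2, h3, odd_mul_div_two, mul_one]

theorem isTheExtremal_copies_two_complete (hd : 3 ≤ d) (hodd : Odd d) :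
    IsTheExtremal d d (copies 2 (complete d)) := by
  have hc := halfCeil_eq d
  refine (isTheExtremal_copies_graphC hd (by omega) ?_).of_isExtremal
    (((witness_complete (d := d) (by omega) le_rfl).copies 2).isExtremal (by omega) (by omega) ?_ ?_)
  · obtain ⟨j, rfl⟩ := hodd
    exact ⟨2, by omega⟩
  · obtain ⟨j, rfl⟩ := hodd
    omega
  · rw [extremalSize_self_of_odd (by omega) hodd, Nat.mul_div_cancel']
    exact (Nat.even_mul_pred_self d).two_dvd

end Extremal

end DegreeMatching

/-! ### Assembly of the theorem -/

open DegreeMatching in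
theorem mainTheorem2 (d m : ℕ) (hd : 2 ≤ d) (hm : 2 ≤ m) :
    -- the cases of uniqueness
    (HasUniqueExtremal d m ↔ d = 2 ∨ (m = 2 ∧ d ≠ 4) ∨ halfCeil d ∣ m - 1) ∧
    -- the unique extremal graph in each of these cases
    (d = 2 → IsTheExtremal d m (copies (m - 1) (complete 2))) ∧
    (m = 2 → d ≠ 3 → d ≠ 4 → maxEdges d m = d - 1 ∧ IsTheExtremal d m (star (d - 1))) ∧
    (3 ≤ d → halfCeil d ∣ m - 1 →
      IsTheExtremal d m (copies ((m - 1) / halfCeil d) (graphC d))) ∧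
    -- the graph `C` and its uniqueness
    (3 ≤ d → IsLargestCritical d (graphC d) ∧
      ∀ (V : Type) [Fintype V] (G : SimpleGraph V),
        IsLargestCritical d G → Nonempty (G ≃g graphC d)) ∧
    -- the remaining cases
    (3 ≤ d → 3 ≤ m → ¬ halfCeil d ∣ m - 1 → HasSeveralExtremal d m) ∧
    (d = 4 → m = 2 → HasSeveralExtremal d m) ∧
    -- the diagonal case
    (d = m → Odd d →
      maxEdges d m = d * (d - 1) ∧ IsTheExtremal d m (copies 2 (complete d))) ∧
    (d = m → Even d →
      maxEdges d m = (2 * d - 1) * (d - 1) / 2 ∧ (4 ≤ d → HasSeveralExtremal d m)) := by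
  have hc := halfCeil_eq d
  have h2 : d = 2 → IsTheExtremal d m (copies (m - 1) (complete 2)) := by
    rintro rfl
    exact isTheExtremal_copies_complete_two hm
  have h3 : m = 2 → d ≠ 3 → d ≠ 4 →
      maxEdges d m = d - 1 ∧ IsTheExtremal d m (star (d - 1)) := by
    rintro rfl hd3 hd4
    rw [maxEdges_eq hd le_rfl]
    rcases hd.eq_or_lt with rfl | hd2
    -- For d = 2 the star is a single edge; being extremal, it inherits uniqueness from the disjoint
    -- union of edges.
    · have hsize : extremalSize 2 2 = 1 := by simp [extremalSize]
      exact ⟨hsize, (h2 rfl).of_isExtremal ((witness_completeBipartiteGraph (d := 2) (r := 1)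
        le_rfl one_lt_two le_rfl).isExtremal le_rfl le_rfl one_lt_two (by omega))⟩
    · exact ⟨extremalSize_two (by omega), isTheExtremal_star (by omega)⟩
  have h4 : 3 ≤ d → halfCeil d ∣ m - 1 →
      IsTheExtremal d m (copies ((m - 1) / halfCeil d) (graphC d)) :=
    fun hd3 => isTheExtremal_copies_graphC hd3 hm
  have h6 : 3 ≤ d → 3 ≤ m → ¬ halfCeil d ∣ m - 1 → HasSeveralExtremal d m :=
    hasSeveralExtremal_of_not_dvd
  have h6' : d = 4 → m = 2 → HasSeveralExtremal d m := by
    rintro rfl rfl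
    exact hasSeveralExtremal_four_two
  refine ⟨⟨fun h => ?_, ?_⟩, h2, h3, h4, fun hd3 => ⟨isLargestCritical_graphC hd3,
    fun V _ G => nonempty_iso_graphC_of_isLargestCritical hd3⟩, h6, h6', ?_, ?_⟩
  · by_contra! hcon
    obtain ⟨hd2, hm2, hdvd⟩ := hcon
    by_cases hm3 : m = 2
    · exact (h6' (hm2 hm3) hm3).not_hasUniqueExtremal h
    · exact (h6 (by omega) (by omega) hdvd).not_hasUniqueExtremal h
  · have hdvd : halfCeil d ∣ m - 1 → HasUniqueExtremal d m := fun h => by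
      by_cases hd2 : d = 2
      · exact ⟨_, _, _, h2 hd2⟩
      · exact ⟨_, _, _, h4 (by omega) h⟩
    rintro (hd2 | ⟨hm2, hd4⟩ | h)
    · exact ⟨_, _, _, h2 hd2⟩
    -- For d = 3 and m = 2 the star is not the extremal graph, but c = 1 divides m-1.
    · by_cases hd3 : d = 3
      · refine hdvd ?_
        rw [hc, hd3]
        exact one_dvd _
      · exact ⟨_, _, _, (h3 hm2 hd3 hd4).2⟩
    · exact hdvd h
  · rintro rfl hodd
    have hd3 : 3 ≤ d := by
      obtain ⟨j, rfl⟩ := hodd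
      omega
    exact ⟨(maxEdges_eq hd hd).trans (extremalSize_self_of_odd hd hodd),
      isTheExtremal_copies_two_complete hd3 hodd⟩
  · rintro rfl heven
    refine ⟨(maxEdges_eq hd hd).trans (extremalSize_self_of_even hd heven), fun hd4 => ?_⟩
    refine h6 (by omega) (by omega) ?_
    obtain ⟨j, rfl⟩ := heven
    rw [hc, show (j + j) / 2 = j by omega]
    -- With d = 2j and j ≥ 2, the number d-1 = 2j-1 lies strictly between j and 2j.
    rintro ⟨t, ht⟩
    have h1 : 1 < t := by
      by_contra! hle
      have := Nat.mul_le_mul_left j hle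
      omega
    have := Nat.mul_le_mul_left j h1
    omega
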